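/- Let $d\ge 1$ and let $\mathbb S^d\subset\mathbb R^{d+1}$ be the unit sphere with its uniform surface measure $\sigma$. Let $K$ be a dot-product kernel on $\mathbb S^d$, $$K(x,y)=\sum_{p=0}^{\infty}c_p\langle x,y\rangle^p ,\qquad c_p\ge 0,$$ where the series is assumed to converge to $K(x,y)$ whenever $y\neq\pm x$. A spherical harmonic of frequency $k$ is the restriction to $\mathbb S^d$ of a homogeneous harmonic polynomial of degree $k$ on $\mathbb R^{d+1}$. In each of the cases below, for every $k\ge 0$ all spherical harmonics $Y$ of frequency $k$ are eigenfunctions of the integral operator of $K$ with a common eigenvalue: there is a unique real number $\overline{\lambda_k}$ with $\int_{\mathbb S^d}K(x,y)Y(y)\,d\sigma(y)=\overline{\lambda_k}\,Y(x)$ for all such $Y$ and all $x\in\mathbb S^d$ (the integrals converge absolutely); moreover $\overline{\lambda_k}\ge 0$. As $p\to\infty$ and $k\to\infty$, these eigenvalues satisfy the following. 1. If $a>1-\frac d2$ and $c_p=\Theta(p^{-a})$, then $\overline{\lambda_k}=\Theta(k^{-d-2a+2})$. 2. If $a>1-\frac d2$, $c_p=0$ for all odd $p$ and $c_p=\Theta(p^{-a})$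 along even $p$, then $\overline{\lambda_k}=0$ for all odd $k$ and $\overline{\lambda_k}=\Theta(k^{-d-2a+2})$ along even $k$. The same holds with "odd" and "even" interchanged. 3. If $a>0$ and $c_p=O(e^{-a\sqrt p})$, then $\overline{\lambda_k}=O(k^{-d+1/2}e^{-a\sqrt k})$. 4. If $a>1$ and $c_p=\Theta(p^{1/2}a^{-p})$, then $\overline{\lambda_k}=O(k^{-d+1}a^{-k})$ and $\overline{\lambda_k}=\Omega(k^{-d/2+1}2^{-k}a^{-k})$. -/

import Mathlib

open Filter Asymptotics MeasureTheory

/-- The unit sphere `S^d` of `ℝ^(d+1)`. -/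
abbrev UnitSphere (d : ℕ) : Type :=
  Metric.sphere (0 : EuclideanSpace ℝ (Fin (d + 1))) 1

/-- The uniform (rotation invariant) surface measure of `S^d`; its total mass is the area. -/
noncomputable def surfaceMeasure (d : ℕ) : Measure (UnitSphere d) :=
  (volume : Measure (EuclideanSpace ℝ (Fin (d + 1)))).toSphere

/-- `Y` is a spherical harmonic of frequency (degree) `k` on `S^d`: the restriction to the sphere of
a homogeneous polynomial of degree `k` in `d + 1` variables whose Laplacian vanishes. -/
def IsSphericalHarmonic (d k : ℕ) (Y : UnitSphere d → ℝ) : Prop :=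
  ∃ P : MvPolynomial (Fin (d + 1)) ℝ, P.IsHomogeneous k ∧
    ∑ i, MvPolynomial.pderiv i (MvPolynomial.pderiv i P) = 0 ∧
    ∀ x : UnitSphere d, Y x = MvPolynomial.eval (fun i => x.1 i) P

/-- `μ` is the eigenvalue, at frequency `k`, of the integral operator with kernel `K` on `S^d`:
nonzero spherical harmonics of frequency `k` exist, and the operator multiplies every one of them
by `μ`. Such a `μ` is unique. -/
def IsEigenvalueAtFrequency (d : ℕ) (K : UnitSphere d → UnitSphere d → ℝ) (k : ℕ) (μ : ℝ) : Prop :=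
  (∃ Y, IsSphericalHarmonic d k Y ∧ Y ≠ 0) ∧
  ∀ Y, IsSphericalHarmonic d k Y → ∀ x,
    Integrable (fun y => K x y * Y y) (surfaceMeasure d) ∧
    ∫ y, K x y * Y y ∂(surfaceMeasure d) = μ * Y x

/-- `K` is a dot-product kernel on `S^d` with power series coefficients `c`. Convergence is asked
only for `y ≠ ± x`; these are the exceptional points at which a series with non-summable
coefficients can diverge, and they form a null set. -/
def IsDotProductKernel (d : ℕ) (c : ℕ → ℝ) (K : UnitSphere d → UnitSphere d → ℝ) : Prop :=
  ∀ x y : UnitSphere d, y ≠ x → y ≠ -x → HasSum (fun p : ℕ => c p * (inner ℝ x.1 y.1) ^ p) (K x y)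

/-- `lam` is the nonnegative sequence of eigenvalues of `K`, indexed by frequency. -/
def IsSpectrum (d : ℕ) (K : UnitSphere d → UnitSphere d → ℝ) (lam : ℕ → ℝ) : Prop :=
  ∀ k, IsEigenvalueAtFrequency d K k (lam k) ∧ 0 ≤ lam k

/-! Write `d = e + 1`. By rotation invariance each kernel `⟨x, y⟩ ^ p` acts on harmonics of degree
`k` by a scalar `sphereCoef e p k`, so the eigenvalue of `K` is `∑' p, c p * sphereCoef e p k`, a
series of nonnegative terms. Everything reduces to computing this scalar, justifying termwise
integration, and estimating the sum.

The scalar is found without Gegenbauer polynomials. Against the Gaussian weight, integration by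
parts turns multiplication by `⟨x, ·⟩` into the derivative along `x`, which preserves harmonicity;
Euler's identity then gives a recursion in `p` and `k` solved by `p! / (p - k)‼`
(`gaussInt_linForm_pow_mul`). Polar coordinates convert this into an integral over the sphere
(`integral_inner_pow_mul_harmonic`), with value `|S^d| (d-1)‼ p! / ((p-k)‼ (p+k+d-1)‼)` for `k ≤ p`
of equal parity and `0` otherwise.

The ratio of the scalars at `k + 2` and `k` is `(p - k) / (p + k + 2 + e)`. Multiplying such ratios
up from frequency `0` or `1` gives heat-kernel behaviour: at most `C p^(-d/2) exp(-k²/(4p))` always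
(`sphereCoef_le`), and at least `c p^(-d/2)` once `p ≥ 2dk²` with matching parity (`le_sphereCoef`).

For `c p ≈ p^(-a)` the sum therefore lives at `p ≳ k²` and has size `(k²)^(1 - a - d/2)`; the
condition on `a` is exactly convergence of `∑ p^(-a - d/2)`. For stretched-exponential and geometric
coefficients the vanishing of terms with `p < k` supplies the main decay, and `exp(-k²/(4p))`
supplies the extra powers of `k`. The geometric lower bound keeps only the term `p = k`. -/

/-! ### Gaussian integrals of polynomials -/

/-- The value of a polynomial at a point of Euclidean space. -/
noncomputable def polyEval {n : ℕ} (P : MvPolynomial (Fin n) ℝ) (x : EuclideanSpace ℝ (Fin n)) : ℝ :=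
  MvPolynomial.eval (fun i => x i) P

/-- The unnormalised Gaussian weight. -/
noncomputable def gaussWeight {n : ℕ} (x : EuclideanSpace ℝ (Fin n)) : ℝ :=
  Real.exp (-(1 / 2) * ‖x‖ ^ (2 : ℝ))

/-- The integral of a polynomial against the Gaussian weight. -/
noncomputable def gaussInt {n : ℕ} (P : MvPolynomial (Fin n) ℝ) : ℝ :=
  ∫ x, polyEval P x * gaussWeight x

lemma continuous_polyEval {n : ℕ} (P : MvPolynomial (Fin n) ℝ) : Continuous (polyEval P) := by
  unfold polyEval
  exact (MvPolynomial.continuous_eval P).comp (by fun_prop)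

lemma continuous_gaussWeight {n : ℕ} :
    Continuous (gaussWeight : EuclideanSpace ℝ (Fin n) → ℝ) := by
  unfold gaussWeight
  simp only [Real.rpow_two]
  fun_prop

lemma integrableOn_pow_mul_exp_neg_half_sq (m : ℕ) :
    IntegrableOn (fun r : ℝ => r ^ m * Real.exp (-(1 / 2) * r ^ (2 : ℝ))) (Set.Ioi 0) := by
  have h := integrableOn_rpow_mul_exp_neg_mul_rpow (p := 2) (s := m) (b := 1 / 2)
    (by have : (0 : ℝ) ≤ m := m.cast_nonneg
        linarith) (by norm_num) (by norm_num)
  refine h.congr_fun (fun r _ => ?_) measurableSet_Ioi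
  simp [Real.rpow_natCast]

lemma abs_polyEval_monomial_le {n : ℕ} (s : Fin n →₀ ℕ) (a : ℝ) (x : EuclideanSpace ℝ (Fin n)) :
    |polyEval (MvPolynomial.monomial s a) x| ≤ |a| * ‖x‖ ^ (∑ i, s i) := by
  rw [polyEval, MvPolynomial.eval_monomial, abs_mul, Finsupp.prod_fintype _ _ (by simp),
    Finset.abs_prod, ← Finset.prod_pow_eq_pow_sum]
  gcongr with i
  rw [abs_pow]
  gcongr
  exact PiLp.norm_apply_le x i

lemma integrable_polyEval_mul_gaussWeight {n : ℕ} (P : MvPolynomial (Fin (n + 1)) ℝ) :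
    Integrable (fun x => polyEval P x * gaussWeight x) := by
  induction P using MvPolynomial.induction_on' with
  | monomial s a =>
    have h : Integrable (fun x : EuclideanSpace ℝ (Fin (n + 1)) =>
        (|a| * ‖x‖ ^ (∑ i, s i)) * gaussWeight x) := by
      refine (integrable_fun_norm_addHaar (volume : Measure (EuclideanSpace ℝ (Fin (n + 1))))
        (f := fun r : ℝ => (|a| * r ^ (∑ i, s i)) *
          Real.exp (-(1 / 2) * r ^ (2 : ℝ)))).2 ?_
      have := (integrableOn_pow_mul_exp_neg_half_sq (n + ∑ i, s i)).const_mul |a|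
      refine IntegrableOn.congr_fun this (fun r _ => ?_) measurableSet_Ioi
      simp only [finrank_euclideanSpace_fin, smul_eq_mul, Nat.add_sub_cancel]
      ring
    refine h.mono' ((continuous_polyEval _).mul continuous_gaussWeight).aestronglyMeasurable
      (Eventually.of_forall fun x => ?_)
    rw [Real.norm_eq_abs, abs_mul, abs_of_pos (show 0 < gaussWeight x from Real.exp_pos _)]
    exact mul_le_mul_of_nonneg_right (abs_polyEval_monomial_le s a x) (Real.exp_pos _).le
  | add p q hp hq =>
    refine (hp.add hq).congr (Eventually.of_forall fun x => ?_)
    simp [polyEval, add_mul]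

lemma gaussInt_add {n : ℕ} (P Q : MvPolynomial (Fin (n + 1)) ℝ) :
    gaussInt (P + Q) = gaussInt P + gaussInt Q := by
  unfold gaussInt
  rw [← integral_add (integrable_polyEval_mul_gaussWeight P) (integrable_polyEval_mul_gaussWeight Q)]
  congr 1; ext x; simp [polyEval, add_mul]

lemma gaussInt_C_mul {n : ℕ} (a : ℝ) (P : MvPolynomial (Fin (n + 1)) ℝ) :
    gaussInt (MvPolynomial.C a * P) = a * gaussInt P := by
  unfold gaussInt
  rw [← integral_const_mul]
  congr 1; ext x; simp [polyEval, mul_assoc]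

lemma gaussInt_zero {n : ℕ} : gaussInt (0 : MvPolynomial (Fin (n + 1)) ℝ) = 0 := by
  simp [gaussInt, polyEval]

lemma gaussInt_sum {n : ℕ} {ι : Type*} (s : Finset ι) (P : ι → MvPolynomial (Fin (n + 1)) ℝ) :
    gaussInt (∑ i ∈ s, P i) = ∑ i ∈ s, gaussInt (P i) := by
  classical
  induction s using Finset.induction_on with
  | empty => simp [gaussInt_zero]
  | insert a s ha ih => rw [Finset.sum_insert ha, Finset.sum_insert ha, gaussInt_add, ih]

lemma hasLineDerivAt_polyEval {n : ℕ} (P : MvPolynomial (Fin n) ℝ) (i : Fin n)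
    (x : EuclideanSpace ℝ (Fin n)) :
    HasLineDerivAt ℝ (polyEval P) (polyEval (MvPolynomial.pderiv i P) x) x
      (EuclideanSpace.single i 1) := by
  unfold HasLineDerivAt
  induction P using MvPolynomial.induction_on with
  | C a =>
    have : (fun t : ℝ => polyEval (MvPolynomial.C a) (x + t • EuclideanSpace.single i (1 : ℝ)))
        = fun _ => a := by ext t; simp [polyEval]
    rw [this]
    simpa [polyEval] using hasDerivAt_const (0 : ℝ) a
  | add p q hp hq =>
    have := hp.add hq
    convert this using 1
    · ext t; simp [polyEval]
    · simp [polyEval]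
  | mul_X p j hp =>
    have hX : HasDerivAt (fun t : ℝ => x j + t * (if j = i then 1 else 0))
        (if j = i then 1 else 0) 0 := by
      simpa using ((hasDerivAt_id (0 : ℝ)).mul_const (if j = i then (1 : ℝ) else 0)).const_add (x j)
    refine ((hp.mul hX).congr_deriv ?_).congr_of_eventuallyEq (Eventually.of_forall fun t => ?_)
    · by_cases h : j = i
      · subst h; simp [polyEval]; ring
      · simp [polyEval, MvPolynomial.pderiv_X_of_ne h, h]; ring
    · simp [polyEval, PiLp.single_apply]

lemma hasLineDerivAt_gaussWeight {n : ℕ} (i : Fin n) (x : EuclideanSpace ℝ (Fin n)) :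
    HasLineDerivAt ℝ gaussWeight (-(x i) * gaussWeight x) x (EuclideanSpace.single i 1) := by
  have h1 : HasFDerivAt (fun y : EuclideanSpace ℝ (Fin n) => ‖y‖ ^ 2) (2 • innerSL ℝ x) x :=
    (hasStrictFDerivAt_norm_sq x).hasFDerivAt
  have h2 := ((h1.const_mul (-(1 / 2 : ℝ))).exp).hasLineDerivAt (EuclideanSpace.single i 1)
  have h3 : (gaussWeight : EuclideanSpace ℝ (Fin n) → ℝ) =
      fun y => Real.exp (-(1 / 2) * ‖y‖ ^ 2) := by
    ext y; simp [gaussWeight]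
  rw [h3]
  unfold HasLineDerivAt at h2 ⊢
  refine h2.congr_deriv ?_
  simp [EuclideanSpace.inner_single_right]
  ring

/-- Gaussian integration by parts. -/
lemma gaussInt_X_mul {n : ℕ} (i : Fin (n + 1)) (P : MvPolynomial (Fin (n + 1)) ℝ) :
    gaussInt (MvPolynomial.X i * P) = gaussInt (MvPolynomial.pderiv i P) := by
  have h := integral_bilinear_hasLineDerivAt_right_eq_neg_left_of_integrable
    (μ := (volume : Measure (EuclideanSpace ℝ (Fin (n + 1)))))
    (f := polyEval P) (f' := polyEval (MvPolynomial.pderiv i P))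
    (g := gaussWeight) (g' := fun x => -(x i) * gaussWeight x)
    (v := EuclideanSpace.single i 1) (B := ContinuousLinearMap.mul ℝ ℝ)
    (integrable_polyEval_mul_gaussWeight _)
    (by
      refine (integrable_polyEval_mul_gaussWeight (MvPolynomial.X i * P)).neg.congr
        (Eventually.of_forall fun x => ?_)
      simp [polyEval]; ring)
    (integrable_polyEval_mul_gaussWeight _)
    (fun x _ => hasLineDerivAt_polyEval P i x) (fun x _ => hasLineDerivAt_gaussWeight i x)
  simp only [ContinuousLinearMap.mul_apply'] at h
  unfold gaussInt
  rw [← neg_inj, ← h, ← integral_neg]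
  congr 1; ext x; simp [polyEval]; ring

/-! ### Powers of a linear form times a harmonic polynomial -/

/-- The linear form `⟨x, ·⟩` as a polynomial. -/
noncomputable def linForm {n : ℕ} (x : EuclideanSpace ℝ (Fin n)) : MvPolynomial (Fin n) ℝ :=
  ∑ i, x i • MvPolynomial.X i

/-- The derivative in direction `x`. -/
noncomputable def dirDeriv {n : ℕ} (x : EuclideanSpace ℝ (Fin n)) :
    Derivation ℝ (MvPolynomial (Fin n) ℝ) (MvPolynomial (Fin n) ℝ) :=
  ∑ i, x i • MvPolynomial.pderiv i

/-- The Laplacian of a polynomial. -/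
noncomputable def polyLaplacian {n : ℕ} (P : MvPolynomial (Fin n) ℝ) : MvPolynomial (Fin n) ℝ :=
  ∑ i, MvPolynomial.pderiv i (MvPolynomial.pderiv i P)

lemma dirDeriv_apply {n : ℕ} (x : EuclideanSpace ℝ (Fin n)) (P : MvPolynomial (Fin n) ℝ) :
    dirDeriv x P = ∑ i, x i • MvPolynomial.pderiv i P := by
  rw [dirDeriv, ← Derivation.coeFnAddMonoidHom_apply, map_sum, Finset.sum_apply]
  rfl

lemma polyEval_linForm {n : ℕ} (x y : EuclideanSpace ℝ (Fin n)) :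
    polyEval (linForm x) y = inner ℝ x y := by
  simp [polyEval, linForm, PiLp.inner_apply, map_sum, mul_comm]

lemma linForm_isHomogeneous {n : ℕ} (x : EuclideanSpace ℝ (Fin n)) :
    (linForm x).IsHomogeneous 1 := by
  refine MvPolynomial.IsHomogeneous.sum _ _ _ fun i _ => ?_
  rw [MvPolynomial.smul_eq_C_mul]
  exact (MvPolynomial.isHomogeneous_X ℝ i).C_mul _

lemma dirDeriv_linForm {n : ℕ} (x : EuclideanSpace ℝ (Fin n)) (hx : ‖x‖ = 1) :
    dirDeriv x (linForm x) = 1 := by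
  have h1 : ∑ i, x i * x i = 1 := by
    have := EuclideanSpace.real_norm_sq_eq x
    rw [hx] at this
    simp only [← sq]; linarith
  rw [dirDeriv_apply]
  have h2 : ∀ i, MvPolynomial.pderiv i (linForm x) = MvPolynomial.C (x i) := by
    intro i
    simp only [linForm, map_sum, Derivation.map_smul]
    rw [Finset.sum_eq_single i]
    · simp [MvPolynomial.smul_eq_C_mul]
    · intro j _ hj; simp [MvPolynomial.pderiv_X_of_ne hj]
    · simp
  simp only [h2, MvPolynomial.smul_eq_C_mul, ← map_mul, ← map_sum, h1, map_one]

lemma gaussInt_linForm_mul {n : ℕ} (x : EuclideanSpace ℝ (Fin (n + 1)))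
    (P : MvPolynomial (Fin (n + 1)) ℝ) : gaussInt (linForm x * P) = gaussInt (dirDeriv x P) := by
  rw [linForm, Finset.sum_mul, dirDeriv_apply, gaussInt_sum, gaussInt_sum]
  refine Finset.sum_congr rfl fun i _ => ?_
  rw [smul_mul_assoc, MvPolynomial.smul_eq_C_mul, MvPolynomial.smul_eq_C_mul, gaussInt_C_mul,
    gaussInt_C_mul, gaussInt_X_mul]

lemma pderiv_pderiv_comm {n : ℕ} (i j : Fin n) (P : MvPolynomial (Fin n) ℝ) :
    MvPolynomial.pderiv i (MvPolynomial.pderiv j P) =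
      MvPolynomial.pderiv j (MvPolynomial.pderiv i P) := by
  have h : ⁅MvPolynomial.pderiv (R := ℝ) i, MvPolynomial.pderiv (R := ℝ) j⁆ = 0 := by
    refine MvPolynomial.derivation_ext fun k => ?_
    rw [Derivation.commutator_apply]
    classical
    simp only [MvPolynomial.pderiv_X, Pi.single_apply]
    split_ifs <;> simp
  have := congrArg (fun D => D P) h
  simp only [Derivation.commutator_apply, Derivation.coe_zero, Pi.zero_apply] at this
  exact sub_eq_zero.1 this

lemma polyLaplacian_dirDeriv {n : ℕ} (x : EuclideanSpace ℝ (Fin n)) (P : MvPolynomial (Fin n) ℝ)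
    (hP : polyLaplacian P = 0) : polyLaplacian (dirDeriv x P) = 0 := by
  have : polyLaplacian (dirDeriv x P) = dirDeriv x (polyLaplacian P) := by
    simp only [polyLaplacian, dirDeriv_apply, map_sum, Derivation.map_smul]
    refine Finset.sum_congr rfl fun i _ => Finset.sum_congr rfl fun j _ => ?_
    rw [pderiv_pderiv_comm j i, pderiv_pderiv_comm j i]
  rw [this, hP, map_zero]

lemma dirDeriv_isHomogeneous {n k : ℕ} (x : EuclideanSpace ℝ (Fin n)) (P : MvPolynomial (Fin n) ℝ)
    (hP : P.IsHomogeneous k) : (dirDeriv x P).IsHomogeneous (k - 1) := by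
  rw [dirDeriv_apply]
  refine MvPolynomial.IsHomogeneous.sum _ _ _ fun i _ => ?_
  rw [MvPolynomial.smul_eq_C_mul]
  exact hP.pderiv.C_mul _

lemma polyEval_dirDeriv_self {n k : ℕ} (x : EuclideanSpace ℝ (Fin n))
    (P : MvPolynomial (Fin n) ℝ) (hP : P.IsHomogeneous k) :
    polyEval (dirDeriv x P) x = k * polyEval P x := by
  have := congrArg (fun Q => polyEval Q x) hP.sum_X_mul_pderiv
  simpa [polyEval, dirDeriv_apply, map_sum] using this

/-- Integrating Euler's identity `∑ Xᵢ ∂ᵢP = kP` by parts turns its left side into the Gaussian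
integral of the Laplacian. -/
lemma gaussInt_harmonic {n k : ℕ} (P : MvPolynomial (Fin (n + 1)) ℝ)
    (hP : P.IsHomogeneous k) (hk : k ≠ 0) (hL : polyLaplacian P = 0) : gaussInt P = 0 := by
  have h := congrArg gaussInt hP.sum_X_mul_pderiv
  simp only [gaussInt_sum, gaussInt_X_mul] at h
  rw [← gaussInt_sum, show (∑ i, MvPolynomial.pderiv i (MvPolynomial.pderiv i P)) = 0 from hL,
    gaussInt_zero, nsmul_eq_mul, ← map_natCast MvPolynomial.C k, gaussInt_C_mul] at h
  exact (mul_eq_zero.1 h.symm).resolve_left (Nat.cast_ne_zero.2 hk)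

/-- The multiplier of `⟨x, ·⟩ ^ p` on harmonic polynomials of degree `k` in Gaussian space. -/
noncomputable def gaussCoef (p k : ℕ) : ℝ :=
  if k ≤ p ∧ p % 2 = k % 2 then (p.factorial : ℝ) / ((p - k).doubleFactorial : ℝ) else 0

lemma gaussCoef_add_two_mul (k j : ℕ) :
    gaussCoef (k + 2 * j) k =
      ((k + 2 * j).factorial : ℝ) / ((2 * j).doubleFactorial : ℝ) := by
  rw [gaussCoef, if_pos ⟨by omega, by omega⟩]
  congr 3; omega

lemma gaussCoef_eq_zero {p k : ℕ} (h : ¬ (k ≤ p ∧ p % 2 = k % 2)) : gaussCoef p k = 0 :=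
  if_neg h

lemma exists_eq_add_two_mul {p k : ℕ} (h : k ≤ p ∧ p % 2 = k % 2) : ∃ j, p = k + 2 * j :=
  ⟨(p - k) / 2, by omega⟩

/-- The recursion produced by integration by parts. The truncated `p - 1` and `k - 1` are harmless:
at `p = 0` or `k = 0` the term in question carries a zero factor. -/
lemma gaussCoef_succ (p k : ℕ) :
    gaussCoef (p + 1) k = p * gaussCoef (p - 1) k + k * gaussCoef p (k - 1) := by
  by_cases h : k ≤ p + 1 ∧ (p + 1) % 2 = k % 2
  · obtain ⟨j, hj⟩ := exists_eq_add_two_mul h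
    rcases k with _ | k
    · rcases j with _ | j
      · omega
      obtain rfl : p = 2 * j + 1 := by omega
      have e1 := gaussCoef_add_two_mul 0 (j + 1)
      have e2 := gaussCoef_add_two_mul 0 j
      have hd := (Nat.doubleFactorial_pos (2 * j)).ne'
      simp only [zero_add] at e1 e2
      rw [show 2 * j + 1 + 1 = 2 * (j + 1) by ring, e1, Nat.add_sub_cancel, e2,
        show 2 * (j + 1) = 2 * j + 2 by ring, Nat.doubleFactorial_add_two,
        Nat.factorial_succ, Nat.factorial_succ]
      push_cast
      have : ((2 * j).doubleFactorial : ℝ) ≠ 0 := by exact_mod_cast hd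
      field_simp
      ring
    · obtain rfl : p = k + 2 * j := by omega
      rw [Nat.add_sub_cancel, gaussCoef_add_two_mul k j, show k + 2 * j + 1 = k + 1 + 2 * j by ring,
        gaussCoef_add_two_mul (k + 1) j]
      rcases j with _ | j
      · rw [gaussCoef_eq_zero (p := k + 2 * 0 - 1) (by omega)]
        simp [Nat.factorial_succ]
      · rw [show k + 2 * (j + 1) - 1 = k + 1 + 2 * j by omega, gaussCoef_add_two_mul (k + 1) j,
          show 2 * (j + 1) = 2 * j + 2 by ring, Nat.doubleFactorial_add_two,
          show k + 1 + (2 * j + 2) = (k + 1 + 2 * j) + 1 + 1 by ring,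
          show k + (2 * j + 2) = (k + 1 + 2 * j) + 1 by ring,
          Nat.factorial_succ (_ + 1), Nat.factorial_succ (k + 1 + 2 * j)]
        have : ((2 * j).doubleFactorial : ℝ) ≠ 0 := by
          exact_mod_cast (Nat.doubleFactorial_pos (2 * j)).ne'
        push_cast
        field_simp
        ring
  · rw [gaussCoef_eq_zero h]
    rcases p with _ | p
    · rcases k with _ | k
      · simp
      · rw [gaussCoef_eq_zero (by omega : ¬ (k + 1 - 1 ≤ 0 ∧ 0 % 2 = (k + 1 - 1) % 2))]; simp
    · rw [gaussCoef_eq_zero (by omega : ¬ (k ≤ p + 1 - 1 ∧ (p + 1 - 1) % 2 = k % 2))]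
      rcases k with _ | k
      · simp
      · rw [gaussCoef_eq_zero (by omega : ¬ (k + 1 - 1 ≤ p + 1 ∧ (p + 1) % 2 = (k + 1 - 1) % 2))]
        simp

/-- One factor `⟨x, ·⟩` becomes `∂ₓ`, which either hits another such factor (`∂ₓ⟨x, ·⟩ = 1` as `‖x‖
= 1`) or hits `P`. In the second case `∂ₓP` is harmonic of degree `k - 1` and takes the value `k
P(x)` at `x`, so strong induction on `p`, uniform in `k` and `P`, closes. -/
lemma gaussInt_linForm_pow_mul {n : ℕ} (x : EuclideanSpace ℝ (Fin (n + 1))) (hx : ‖x‖ = 1) (p : ℕ) :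
    ∀ (k : ℕ) (P : MvPolynomial (Fin (n + 1)) ℝ), P.IsHomogeneous k → polyLaplacian P = 0 →
      gaussInt (linForm x ^ p * P) =
        gaussCoef p k * polyEval P x * gaussInt (1 : MvPolynomial (Fin (n + 1)) ℝ) := by
  induction p using Nat.strong_induction_on with
  | _ p ih =>
  intro k P hP hL
  rcases p with _ | p
  · rw [pow_zero, one_mul]
    rcases k with _ | k
    · rw [← MvPolynomial.totalDegree_zero_iff_isHomogeneous,
        MvPolynomial.totalDegree_eq_zero_iff_eq_C] at hP
      rw [hP, ← mul_one (MvPolynomial.C _), gaussInt_C_mul]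
      simp [gaussCoef, polyEval]
    · rw [gaussInt_harmonic P hP (by omega) hL, gaussCoef_eq_zero (by omega)]
      simp
  · have hD : dirDeriv x (linForm x ^ p * P) =
        MvPolynomial.C (p : ℝ) * (linForm x ^ (p - 1) * P) + linForm x ^ p * dirDeriv x P := by
      rw [Derivation.leibniz, Derivation.leibniz_pow, dirDeriv_linForm x hx]
      simp only [smul_eq_mul, nsmul_eq_mul, map_natCast]
      ring
    rw [pow_succ', mul_assoc, gaussInt_linForm_mul, hD, gaussInt_add, gaussInt_C_mul,
      ih p (by omega) (k - 1) _ (dirDeriv_isHomogeneous x P hP) (polyLaplacian_dirDeriv x P hL),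
      polyEval_dirDeriv_self x P hP, ih (p - 1) (by omega) k P hP hL, gaussCoef_succ]
    ring

/-! ### Polar coordinates -/

/-- Radial Gaussian moments. -/
noncomputable def radialMoment (m : ℕ) : ℝ :=
  ∫ r in Set.Ioi (0 : ℝ), r ^ m * Real.exp (-(1 / 2) * r ^ (2 : ℝ))

lemma radialMoment_eq (m : ℕ) :
    radialMoment m =
      (1 / 2 : ℝ) ^ (-((m : ℝ) + 1) / 2) * (1 / 2) * Real.Gamma (((m : ℝ) + 1) / 2) := by
  have hm : (0 : ℝ) ≤ m := m.cast_nonneg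
  rw [← integral_rpow_mul_exp_neg_mul_rpow (p := 2) (q := m) (b := 1 / 2) (by norm_num)
    (by linarith) (by norm_num), radialMoment]
  simp only [Real.rpow_natCast]

lemma radialMoment_pos (m : ℕ) : 0 < radialMoment m := by
  rw [radialMoment_eq]
  have := Real.Gamma_pos_of_pos (show (0 : ℝ) < ((m : ℝ) + 1) / 2 by positivity)
  positivity

lemma radialMoment_add_two (m : ℕ) : radialMoment (m + 2) = (m + 1) * radialMoment m := by
  rw [radialMoment_eq, radialMoment_eq]
  push_cast
  rw [show ((m : ℝ) + 2 + 1) / 2 = ((m : ℝ) + 1) / 2 + 1 by ring,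
    Real.Gamma_add_one (by positivity),
    show -((m : ℝ) + 2 + 1) / 2 = -((m : ℝ) + 1) / 2 - 1 by ring,
    Real.rpow_sub_one (by norm_num)]
  ring

lemma radialMoment_add_two_mul (d s : ℕ) :
    radialMoment (d + 1 + 2 * s) * (d.doubleFactorial : ℝ) =
      ((d + 2 * s).doubleFactorial : ℝ) * radialMoment (d + 1) := by
  induction s with
  | zero => simp [mul_comm]
  | succ s ih =>
    rw [show d + 1 + 2 * (s + 1) = d + 1 + 2 * s + 2 by ring, radialMoment_add_two, mul_assoc, ih,
      show d + 2 * (s + 1) = d + 2 * s + 2 by ring, Nat.doubleFactorial_add_two]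
    push_cast
    ring

lemma polyEval_smul {n k : ℕ} (P : MvPolynomial (Fin n) ℝ) (hP : P.IsHomogeneous k) (r : ℝ)
    (x : EuclideanSpace ℝ (Fin n)) : polyEval P (r • x) = r ^ k * polyEval P x := by
  rw [polyEval, polyEval, MvPolynomial.eval_eq, MvPolynomial.eval_eq, Finset.mul_sum]
  refine Finset.sum_congr rfl fun s hs => ?_
  have h1 : ∑ i ∈ s.support, s i = k := by
    have := hP (MvPolynomial.mem_support_iff.1 hs)
    simpa [Finsupp.weight_apply, Finsupp.sum] using this
  simp only [PiLp.smul_apply, smul_eq_mul, mul_pow, Finset.prod_mul_distrib,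
    Finset.prod_pow_eq_pow_sum, h1]
  ring

lemma integral_volumeIoiPow (n : ℕ) (f : ℝ → ℝ) :
    ∫ r : Set.Ioi (0 : ℝ), f r ∂(Measure.volumeIoiPow n) = ∫ r in Set.Ioi (0 : ℝ), r ^ n * f r := by
  simp only [Measure.volumeIoiPow, ENNReal.ofReal]
  rw [integral_withDensity_eq_integral_smul,
    integral_subtype_comap measurableSet_Ioi fun a ↦ Real.toNNReal (a ^ n) • f a,
    setIntegral_congr_fun measurableSet_Ioi fun x hx ↦ ?_]
  · simp only [NNReal.smul_def, Real.coe_toNNReal _ (pow_nonneg (Set.mem_Ioi.1 hx).le _)]; rfl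
  · exact (measurable_subtype_coe.pow_const _).real_toNNReal

/-- Homogeneity splits the integrand in polar coordinates into an angular and a radial factor; the
exponent `d + k` joins the Jacobian `r ^ d` to `r ^ k`. -/
lemma gaussInt_eq_sphere {d k : ℕ} (P : MvPolynomial (Fin (d + 1)) ℝ) (hP : P.IsHomogeneous k) :
    gaussInt P = (∫ y, polyEval P y.1 ∂(surfaceMeasure d)) * radialMoment (d + k) := by
  set f : EuclideanSpace ℝ (Fin (d + 1)) → ℝ := fun x => polyEval P x * gaussWeight x with hf
  have h1 : gaussInt P = ∫ x : ({(0)}ᶜ : Set (EuclideanSpace ℝ (Fin (d + 1)))), f x.1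
      ∂((volume : Measure (EuclideanSpace ℝ (Fin (d + 1)))).comap (↑)) := by
    rw [integral_subtype_comap (measurableSet_singleton _).compl f,
      restrict_compl_singleton]
    rfl
  have h2 := (volume : Measure (EuclideanSpace ℝ
    (Fin (d + 1)))).measurePreserving_homeomorphUnitSphereProd.integral_comp
      (Homeomorph.measurableEmbedding _) (fun z => f (z.2.1 • z.1.1))
  have h3 : ∀ x : ({(0)}ᶜ : Set (EuclideanSpace ℝ (Fin (d + 1)))),
      f (((homeomorphUnitSphereProd _ x).2 : ℝ) • ((homeomorphUnitSphereProd _ x).1).1) = f x.1 := by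
    intro x
    have hx : ‖x.1‖ ≠ 0 := norm_ne_zero_iff.2 x.2
    congr 1
    simp [smul_smul, hx]
  have h4 : ∀ z : UnitSphere d × Set.Ioi (0 : ℝ), f (z.2.1 • z.1.1) =
      polyEval P z.1.1 * (z.2.1 ^ k * Real.exp (-(1 / 2) * z.2.1 ^ (2 : ℝ))) := by
    intro z
    have hz : ‖z.1.1‖ = 1 := by simp
    simp only [hf, polyEval_smul P hP, gaussWeight, norm_smul, hz, mul_one, Real.norm_eq_abs,
      abs_of_pos (Set.mem_Ioi.1 z.2.2)]
    ring
  simp only [h3, h4] at h2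
  rw [h1, h2, surfaceMeasure, radialMoment,
    integral_prod_mul (fun y : UnitSphere d => polyEval P y.1)
      (fun r : Set.Ioi (0 : ℝ) => r.1 ^ k * Real.exp (-(1 / 2) * r.1 ^ (2 : ℝ)))]
  congr 1
  rw [integral_volumeIoiPow _ (fun r => r ^ k * Real.exp (-(1 / 2) * r ^ (2 : ℝ)))]
  simp only [finrank_euclideanSpace_fin, Nat.add_sub_cancel, pow_add, mul_assoc]

/-- The normalising constant `|S^d| (d-1)‼`, where `d = e + 1`. -/
noncomputable def sphereConst (e : ℕ) : ℝ :=
  (surfaceMeasure (e + 1)).real Set.univ * (e.doubleFactorial : ℝ)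

lemma sphereConst_pos (e : ℕ) : 0 < sphereConst e := by
  have h : surfaceMeasure (e + 1) ≠ 0 := Measure.toSphere_ne_zero _
  have : IsFiniteMeasure (surfaceMeasure (e + 1)) := by unfold surfaceMeasure; infer_instance
  refine mul_pos ?_ (by exact_mod_cast Nat.doubleFactorial_pos e)
  exact ENNReal.toReal_pos (by simpa using h) (measure_ne_top _ _)

/-- The eigenvalue of the kernel `⟨x, y⟩ ^ p` at frequency `k` on the sphere `S^(e+1)`. -/
noncomputable def sphereCoef (e p k : ℕ) : ℝ :=
  sphereConst e * (gaussCoef p k / ((p + k + e).doubleFactorial : ℝ))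

/-- The Funk–Hecke formula for the kernel `⟨x, y⟩ ^ p`. -/
lemma integral_inner_pow_mul_harmonic (e p k : ℕ) (P : MvPolynomial (Fin (e + 1 + 1)) ℝ)
    (hP : P.IsHomogeneous k) (hL : polyLaplacian P = 0) (x : UnitSphere (e + 1)) :
    ∫ y, (inner ℝ x.1 y.1) ^ p * polyEval P y.1 ∂(surfaceMeasure (e + 1)) =
      sphereCoef e p k * polyEval P x.1 := by
  have hx : ‖x.1‖ = 1 := by simp
  have h1 := gaussInt_linForm_pow_mul x.1 hx p k P hP hL
  have hh : (linForm x.1 ^ p * P).IsHomogeneous (p + k) := by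
    simpa using ((linForm_isHomogeneous x.1).pow p).mul hP
  rw [gaussInt_eq_sphere _ hh, gaussInt_eq_sphere 1 (MvPolynomial.isHomogeneous_one _ _)] at h1
  have h2 : ∀ y : EuclideanSpace ℝ (Fin (e + 1 + 1)), polyEval (linForm x.1 ^ p * P) y =
      (inner ℝ x.1 y) ^ p * polyEval P y := by
    intro y
    rw [← polyEval_linForm]
    simp [polyEval]
  have h3 : ∀ y : EuclideanSpace ℝ (Fin (e + 1 + 1)),
      polyEval (1 : MvPolynomial (Fin (e + 1 + 1)) ℝ) y = 1 := by
    intro y; simp [polyEval]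
  simp only [h2, h3, integral_const, smul_eq_mul, mul_one, add_zero] at h1
  have hR := (radialMoment_pos (e + 1 + (p + k))).ne'
  rw [← mul_right_cancel_iff_of_pos (radialMoment_pos (e + 1 + (p + k))), h1, sphereCoef]
  by_cases h : k ≤ p ∧ p % 2 = k % 2
  -- Equal parity makes `p + k` even, so the two radial moments are linked by steps of two and their
  -- ratio is a quotient of double factorials.
  · obtain ⟨s, hs⟩ : ∃ s, p + k = 2 * s := ⟨(p + k) / 2, by omega⟩
    have := radialMoment_add_two_mul e s
    have hd : (((p + k + e).doubleFactorial : ℕ) : ℝ) ≠ 0 := by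
      exact_mod_cast (Nat.doubleFactorial_pos _).ne'
    rw [← hs] at this
    rw [show p + k + e = e + (p + k) by ring] at hd ⊢
    rw [sphereConst]
    field_simp
    linear_combination (-1 : ℝ) * gaussCoef p k * polyEval P x.1 * (surfaceMeasure (e + 1)).real Set.univ * this
  · simp [gaussCoef_eq_zero h]

lemma sphereCoef_nonneg (e p k : ℕ) : 0 ≤ sphereCoef e p k := by
  have := (sphereConst_pos e).le
  unfold sphereCoef gaussCoef
  split_ifs <;> positivity

lemma sphereCoef_eq_zero {e p k : ℕ} (h : ¬ (k ≤ p ∧ p % 2 = k % 2)) : sphereCoef e p k = 0 := by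
  simp [sphereCoef, gaussCoef_eq_zero h]

/-! ### Termwise integration of the kernel -/

/-- The series is only assumed to converge almost everywhere, which is all that is known for the
kernel. Integrability of the limit follows from `∫ |f| ≤ ∑ ∫ |F p|`. -/
lemma integrable_and_hasSum_integral {α : Type*} [MeasurableSpace α] {μ : Measure α}
    {F : ℕ → α → ℝ} {f : α → ℝ} (hF : ∀ p, Integrable (F p) μ)
    (hs : Summable fun p => ∫ a, ‖F p a‖ ∂μ) (hf : ∀ᵐ a ∂μ, HasSum (fun p => F p a) (f a)) :
    Integrable f μ ∧ HasSum (fun p => ∫ a, F p a ∂μ) (∫ a, f a ∂μ) := by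
  refine ⟨⟨?_, ?_⟩, ?_⟩
  · exact aestronglyMeasurable_of_tendsto_ae atTop
      (f := fun (n : ℕ) a => ∑ p ∈ Finset.range n, F p a)
      (fun n => (integrable_finsetSum _ fun p _ => hF p).1)
      (hf.mono fun a ha => ha.tendsto_sum_nat)
  · have h1 (p : ℕ) : ∫⁻ a, ‖F p a‖ₑ ∂μ = ENNReal.ofReal (∫ a, ‖F p a‖ ∂μ) := by
      rw [ofReal_integral_norm_eq_lintegral_enorm (hF p)]
    calc ∫⁻ a, ‖f a‖ₑ ∂μ ≤ ∫⁻ a, ∑' p, ‖F p a‖ₑ ∂μ := by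
          refine lintegral_mono_ae (hf.mono fun a ha => ?_)
          rw [← ha.tsum_eq]
          exact enorm_tsum_le_tsum_enorm
      _ = ∑' p, ENNReal.ofReal (∫ a, ‖F p a‖ ∂μ) := by
          rw [lintegral_tsum fun p => (hF p).1.enorm]
          simp only [h1]
      _ < ⊤ := by
          rw [← ENNReal.ofReal_tsum_of_nonneg
            (fun p => integral_nonneg fun a => norm_nonneg _) hs]
          exact ENNReal.ofReal_lt_top
  · rw [integral_congr_ae (hf.mono fun a ha => ha.tsum_eq.symm)]
    exact hasSum_integral_of_summable_integral_norm hF hs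

/-- The cone over a point lies in a line, a proper subspace because the ambient dimension is `e + 2
≥ 2`. -/
lemma surfaceMeasure_singleton (e : ℕ) (x : UnitSphere (e + 1)) :
    surfaceMeasure (e + 1) {x} = 0 := by
  rw [surfaceMeasure, Measure.toSphere_apply' _ (measurableSet_singleton x)]
  refine mul_eq_zero_of_right _ (measure_mono_null (t := (ℝ ∙ x.1 : Set _)) ?_ ?_)
  · rw [Set.image_singleton]
    rintro _ ⟨r, _, _, rfl, rfl⟩
    exact Submodule.smul_mem _ _ (Submodule.mem_span_singleton_self _)
  · refine Measure.addHaar_submodule _ _ fun h => ?_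
    have h1 := finrank_span_le_card (R := ℝ) ({x.1} : Set (EuclideanSpace ℝ (Fin (e + 1 + 1))))
    rw [h, finrank_top, finrank_euclideanSpace_fin] at h1
    simp at h1

instance (d : ℕ) : IsFiniteMeasure (surfaceMeasure d) := by
  unfold surfaceMeasure; infer_instance

lemma integrable_of_continuous_sphere {d : ℕ} {f : UnitSphere d → ℝ} (hf : Continuous f) :
    Integrable f (surfaceMeasure d) :=
  hf.integrable_of_hasCompactSupport (HasCompactSupport.of_compactSpace f)

lemma abs_inner_sphere_le_one {d : ℕ} (x y : UnitSphere d) : |inner ℝ x.1 y.1| ≤ 1 := by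
  simpa using abs_real_inner_le_norm x.1 y.1

lemma integral_inner_pow (e p : ℕ) (x : UnitSphere (e + 1)) :
    ∫ y, (inner ℝ x.1 y.1) ^ p ∂(surfaceMeasure (e + 1)) = sphereCoef e p 0 := by
  have := integral_inner_pow_mul_harmonic e p 0 1 (MvPolynomial.isHomogeneous_one _ _)
    (by simp [polyLaplacian]) x
  simpa [polyEval] using this

lemma kernel_integral (e k : ℕ) (c : ℕ → ℝ) (hc : ∀ p, 0 ≤ c p)
    (K : UnitSphere (e + 1) → UnitSphere (e + 1) → ℝ) (hK : IsDotProductKernel (e + 1) c K)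
    (hs : Summable fun p => c p * sphereCoef e (2 * (p / 2)) 0)
    (P : MvPolynomial (Fin (e + 1 + 1)) ℝ) (hP : P.IsHomogeneous k) (hL : polyLaplacian P = 0)
    (x : UnitSphere (e + 1)) :
    Integrable (fun y => K x y * polyEval P y.1) (surfaceMeasure (e + 1)) ∧
    HasSum (fun p => c p * sphereCoef e p k * polyEval P x.1)
      (∫ y, K x y * polyEval P y.1 ∂(surfaceMeasure (e + 1))) := by
  have hcont : Continuous fun y : UnitSphere (e + 1) => polyEval P y.1 :=
    (continuous_polyEval P).comp continuous_subtype_val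
  obtain ⟨M, hM⟩ := isCompact_univ.exists_bound_of_continuousOn hcont.continuousOn
  have hF (p : ℕ) : Continuous fun y : UnitSphere (e + 1) =>
      c p * (inner ℝ x.1 y.1) ^ p * polyEval P y.1 := by fun_prop
  have h := integrable_and_hasSum_integral (μ := surfaceMeasure (e + 1))
    (F := fun p y => c p * (inner ℝ x.1 y.1) ^ p * polyEval P y.1)
    (f := fun y => K x y * polyEval P y.1)
    (fun p => integrable_of_continuous_sphere (hF p)) ?_ ?_
  · refine ⟨h.1, ?_⟩
    convert h.2 using 2 with p
    simp only [mul_assoc]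
    rw [integral_const_mul, integral_inner_pow_mul_harmonic e p k P hP hL x]
  · refine (hs.mul_right M).of_nonneg_of_le (fun p => integral_nonneg fun y => norm_nonneg _)
      fun p => ?_
    rw [← integral_inner_pow e _ x, mul_assoc, ← integral_mul_const, ← integral_const_mul]
    refine integral_mono (integrable_of_continuous_sphere (hF p).norm)
      (integrable_of_continuous_sphere (by fun_prop)) fun y => ?_
    have hy := hM y (Set.mem_univ _)
    -- Rounding the exponent down to an even one removes the absolute value, so the dominating
    -- integral is again an explicit `sphereCoef` at frequency `0`.
    have h1 : |inner ℝ x.1 y.1| ^ p ≤ (inner ℝ x.1 y.1) ^ (2 * (p / 2)) := by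
      rw [← Even.pow_abs (even_two_mul (p / 2)) (inner ℝ x.1 y.1)]
      exact pow_le_pow_of_le_one (abs_nonneg _) (abs_inner_sphere_le_one x y) (by omega)
    have h2 : 0 ≤ (inner ℝ x.1 y.1) ^ (2 * (p / 2)) := (even_two_mul _).pow_nonneg _
    rw [norm_mul, norm_mul, norm_pow, Real.norm_eq_abs, Real.norm_eq_abs, abs_of_nonneg (hc p),
      mul_assoc]
    exact mul_le_mul_of_nonneg_left (mul_le_mul h1 hy (norm_nonneg _) h2) (hc p)
  · have hne (z : UnitSphere (e + 1)) : ∀ᵐ y ∂(surfaceMeasure (e + 1)), y ≠ z :=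
      compl_mem_ae_iff.2 (surfaceMeasure_singleton e z)
    filter_upwards [hne x, hne (-x)] with y h1 h2
    exact (hK x y h1 h2).mul_right _

/-! ### Nonzero harmonic polynomials -/

/-- The real and imaginary parts of `(X₀ + i X₁) ^ k`. -/
noncomputable def complexPowParts (n : ℕ) :
    ℕ → MvPolynomial (Fin (n + 2)) ℝ × MvPolynomial (Fin (n + 2)) ℝ
  | 0 => (1, 0)
  | k + 1 => (MvPolynomial.X 0 * (complexPowParts n k).1 - MvPolynomial.X 1 * (complexPowParts n k).2,
      MvPolynomial.X 0 * (complexPowParts n k).2 + MvPolynomial.X 1 * (complexPowParts n k).1)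

lemma complexPowParts_isHomogeneous (n k : ℕ) :
    (complexPowParts n k).1.IsHomogeneous k ∧ (complexPowParts n k).2.IsHomogeneous k := by
  induction k with
  | zero => exact ⟨MvPolynomial.isHomogeneous_one _ _, MvPolynomial.isHomogeneous_zero _ _ _⟩
  | succ k ih =>
    have h (i : Fin (n + 2)) {Q : MvPolynomial (Fin (n + 2)) ℝ} (hQ : Q.IsHomogeneous k) :
        (MvPolynomial.X i * Q).IsHomogeneous (k + 1) := by
      simpa [add_comm] using (MvPolynomial.isHomogeneous_X ℝ i).mul hQ
    exact ⟨(h 0 ih.1).sub (h 1 ih.2), (h 0 ih.2).add (h 1 ih.1)⟩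

/-- The Cauchy–Riemann equations together with `(z ^ k)' = k z ^ (k - 1)`; no other variable occurs.
-/
lemma pderiv_complexPowParts (n k : ℕ) :
    (MvPolynomial.pderiv 0 (complexPowParts n k).1 = k * (complexPowParts n (k - 1)).1 ∧
      MvPolynomial.pderiv 0 (complexPowParts n k).2 = k * (complexPowParts n (k - 1)).2) ∧
    (MvPolynomial.pderiv 1 (complexPowParts n k).1 = -(k * (complexPowParts n (k - 1)).2) ∧
      MvPolynomial.pderiv 1 (complexPowParts n k).2 = k * (complexPowParts n (k - 1)).1) ∧
    ∀ i : Fin n, MvPolynomial.pderiv i.succ.succ (complexPowParts n k).1 = 0 ∧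
      MvPolynomial.pderiv i.succ.succ (complexPowParts n k).2 = 0 := by
  have h01 : (0 : Fin (n + 2)) ≠ 1 := by simp
  have h0 (i : Fin n) : (0 : Fin (n + 2)) ≠ i.succ.succ := (Fin.succ_ne_zero _).symm
  have h1 (i : Fin n) : (1 : Fin (n + 2)) ≠ i.succ.succ := by
    rw [← Fin.succ_zero_eq_one, Ne, Fin.succ_inj]; exact (Fin.succ_ne_zero _).symm
  induction k with
  | zero => simp [complexPowParts]
  | succ k ih =>
    obtain ⟨⟨a1, a2⟩, ⟨b1, b2⟩, h⟩ := ih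
    -- The factor `k` keeps the identity true at `k = 0`, where `k - 1` truncates.
    have hk : (k : MvPolynomial (Fin (n + 2)) ℝ) * (complexPowParts n k).1 =
        (k : MvPolynomial (Fin (n + 2)) ℝ) * (MvPolynomial.X 0 * (complexPowParts n (k - 1)).1 -
          MvPolynomial.X 1 * (complexPowParts n (k - 1)).2) ∧
      (k : MvPolynomial (Fin (n + 2)) ℝ) * (complexPowParts n k).2 =
        (k : MvPolynomial (Fin (n + 2)) ℝ) * (MvPolynomial.X 0 * (complexPowParts n (k - 1)).2 +
          MvPolynomial.X 1 * (complexPowParts n (k - 1)).1) := by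
      rcases k with _ | k
      · simp
      · exact ⟨rfl, rfl⟩
    simp only [complexPowParts, map_sub, map_add, MvPolynomial.pderiv_mul, a1, a2, b1, b2,
      MvPolynomial.pderiv_X_self, MvPolynomial.pderiv_X_of_ne h01,
      MvPolynomial.pderiv_X_of_ne h01.symm, Nat.add_sub_cancel, Nat.cast_add, Nat.cast_one]
    refine ⟨⟨?_, ?_⟩, ⟨?_, ?_⟩, fun i => ?_⟩
    · linear_combination -hk.1
    · linear_combination -hk.2
    · linear_combination hk.2
    · linear_combination -hk.1
    · simp [MvPolynomial.pderiv_X_of_ne (h0 i), MvPolynomial.pderiv_X_of_ne (h1 i), h i]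

lemma polyLaplacian_complexPowParts (n k : ℕ) : polyLaplacian (complexPowParts n k).1 = 0 := by
  have h (k : ℕ) := pderiv_complexPowParts n k
  have hn (m : ℕ) (i : Fin (n + 2)) : MvPolynomial.pderiv i (m : MvPolynomial (Fin (n + 2)) ℝ) = 0 :=
    Derivation.map_natCast _ m
  rw [polyLaplacian, Fin.sum_univ_succ, Fin.sum_univ_succ, Fin.succ_zero_eq_one]
  simp [(h _).1.1, (h _).2.1.1, ((h _).2.2 _).1, hn, (h _).2.1.2]

lemma exists_harmonic (e k : ℕ) : ∃ P : MvPolynomial (Fin (e + 1 + 1)) ℝ, P.IsHomogeneous k ∧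
    polyLaplacian P = 0 ∧ ∃ x : UnitSphere (e + 1), polyEval P x.1 = 1 := by
  refine ⟨(complexPowParts e k).1, (complexPowParts_isHomogeneous e k).1,
    polyLaplacian_complexPowParts e k, ⟨EuclideanSpace.single 0 1, by simp⟩, ?_⟩
  suffices h : polyEval (complexPowParts e k).1 (EuclideanSpace.single 0 (1 : ℝ)) = 1 ∧
      polyEval (complexPowParts e k).2 (EuclideanSpace.single 0 (1 : ℝ)) = 0 from h.1
  induction k with
  | zero => simp [complexPowParts, polyEval]
  | succ k ih =>
    simpa [complexPowParts, polyEval] using ih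

lemma isSpectrum_of_summable (e : ℕ) (c : ℕ → ℝ) (hc : ∀ p, 0 ≤ c p)
    (K : UnitSphere (e + 1) → UnitSphere (e + 1) → ℝ) (hK : IsDotProductKernel (e + 1) c K)
    (hs : Summable fun p => c p * sphereCoef e (2 * (p / 2)) 0) :
    (∀ k, Summable fun p => c p * sphereCoef e p k) ∧
      IsSpectrum (e + 1) K (fun k => ∑' p, c p * sphereCoef e p k) := by
  -- Testing the kernel on a harmonic equal to `1` at some point isolates the scalar series.
  have hsum (k : ℕ) : Summable fun p => c p * sphereCoef e p k := by
    obtain ⟨P, hP, hL, x, hx⟩ := exists_harmonic e k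
    have := (kernel_integral e k c hc K hK hs P hP hL x).2.summable
    simpa [hx] using this
  refine ⟨hsum, fun k => ⟨⟨?_, ?_⟩, tsum_nonneg fun p => mul_nonneg (hc p) (sphereCoef_nonneg e p k)⟩⟩
  · obtain ⟨P, hP, hL, x, hx⟩ := exists_harmonic e k
    refine ⟨fun y => polyEval P y.1, ⟨P, hP, hL, fun _ => rfl⟩, fun h => ?_⟩
    have := congrFun h x
    simp [hx] at this
  · rintro Y ⟨P, hP, hL, hY⟩ x
    obtain rfl : Y = fun y => polyEval P y.1 := funext hY
    obtain ⟨h1, h2⟩ := kernel_integral e k c hc K hK hs P hP hL x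
    exact ⟨h1, h2.unique ((hsum k).hasSum.mul_right _)⟩

/-! ### Two-sided bounds for the eigenvalues of `⟨x, y⟩ ^ p` -/

/-- A Wallis-type estimate: the ratio decays like `q^(-1/2)`. Squaring avoids roots, and induction
in steps of two fits the double factorial. -/
lemma doubleFactorial_ratio_sq_bounds (q : ℕ) :
    1 / (2 * ((q : ℝ) + 1)) ≤ ((q.doubleFactorial : ℝ) / ((q + 1).doubleFactorial : ℝ)) ^ 2 ∧
      ((q.doubleFactorial : ℝ) / ((q + 1).doubleFactorial : ℝ)) ^ 2 ≤ 2 / ((q : ℝ) + 2) := by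
  induction q using Nat.twoStepInduction with
  | zero => norm_num [Nat.doubleFactorial]
  | one => norm_num [Nat.doubleFactorial]
  | more q ih _ =>
    obtain ⟨h1, h2⟩ := ih
    rw [show q + 2 + 1 = q + 1 + 2 by ring, Nat.doubleFactorial_add_two,
      Nat.doubleFactorial_add_two]
    have hq : (0 : ℝ) ≤ q := q.cast_nonneg
    have e : (((q + 2) * q.doubleFactorial : ℕ) : ℝ) /
        (((q + 1 + 2) * (q + 1).doubleFactorial : ℕ) : ℝ) =
        (((q : ℝ) + 2) / (q + 3)) * ((q.doubleFactorial : ℝ) / ((q + 1).doubleFactorial : ℝ)) := by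
      push_cast
      rw [show (q : ℝ) + 1 + 2 = q + 3 by ring]
      exact mul_div_mul_comm _ _ _ _
    rw [e, mul_pow]
    push_cast
    constructor
    · calc 1 / (2 * ((q : ℝ) + 2 + 1)) ≤ (((q : ℝ) + 2) / (q + 3)) ^ 2 * (1 / (2 * ((q : ℝ) + 1))) := by
            rw [div_pow, div_mul_div_comm, div_le_div_iff₀ (by positivity) (by positivity)]
            nlinarith [mul_nonneg hq hq]
        _ ≤ _ := by gcongr
    · calc _ ≤ (((q : ℝ) + 2) / (q + 3)) ^ 2 * (2 / ((q : ℝ) + 2)) := by gcongr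
        _ ≤ _ := by
            rw [div_pow, div_mul_div_comm, div_le_div_iff₀ (by positivity) (by positivity)]
            nlinarith [mul_nonneg hq hq]

lemma doubleFactorial_div_sq_bounds (q n : ℕ) :
    1 / (2 * ((q : ℝ) + n)) ^ n ≤ ((q.doubleFactorial : ℝ) / ((q + n).doubleFactorial : ℝ)) ^ 2 ∧
      ((q.doubleFactorial : ℝ) / ((q + n).doubleFactorial : ℝ)) ^ 2 ≤ (2 / ((q : ℝ) + 1)) ^ n := by
  have hpos (m : ℕ) : (0 : ℝ) < m.doubleFactorial := by exact_mod_cast Nat.doubleFactorial_pos m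
  induction n with
  | zero => simp [(hpos q).ne']
  | succ n ih =>
    obtain ⟨h1, h2⟩ := ih
    obtain ⟨h3, h4⟩ := doubleFactorial_ratio_sq_bounds (q + n)
    have e : (q.doubleFactorial : ℝ) / ((q + (n + 1)).doubleFactorial : ℝ) =
        ((q.doubleFactorial : ℝ) / ((q + n).doubleFactorial : ℝ)) *
          (((q + n).doubleFactorial : ℝ) / ((q + n + 1).doubleFactorial : ℝ)) := by
      rw [div_mul_div_cancel₀ (hpos _).ne']; rfl
    have hq : (0 : ℝ) ≤ q := q.cast_nonneg
    have hn : (0 : ℝ) ≤ n := n.cast_nonneg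
    rw [e, mul_pow _ _ 2]
    push_cast at h3 h4 ⊢
    constructor
    · rw [pow_succ _ n, one_div, mul_inv, ← one_div, ← one_div]
      refine mul_le_mul ?_ (by rw [← add_assoc]; exact h3) (by positivity) (by positivity)
      rcases Nat.eq_zero_or_pos n with rfl | hn0
      · simpa using h1
      · have : (0 : ℝ) < n := by exact_mod_cast hn0
        refine le_trans ?_ h1
        gcongr
        linarith
    · rw [pow_succ _ n]
      refine mul_le_mul h2 (h4.trans ?_) (by positivity) (by positivity)
      exact div_le_div_of_nonneg_left (by norm_num) (by positivity) (by linarith)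

/-- At the lowest frequency of the right parity, `p! = p‼ (p-1)‼` cancels one double factorial. The
witness `q` is the odd one of `p - 1` and `p`. -/
lemma sphereCoef_base (e p : ℕ) (hp : 1 ≤ p) : ∃ q : ℕ, p ≤ q + 1 ∧ q ≤ p ∧
    sphereCoef e p (p % 2) =
      sphereConst e * ((q.doubleFactorial : ℝ) / ((q + (e + 1)).doubleFactorial : ℝ)) := by
  have hpos (m : ℕ) : (m.doubleFactorial : ℝ) ≠ 0 := by
    exact_mod_cast (Nat.doubleFactorial_pos m).ne'
  rcases Nat.even_or_odd' p with ⟨j, rfl | rfl⟩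
  · obtain ⟨i, rfl⟩ : ∃ i, j = i + 1 := ⟨j - 1, by omega⟩
    refine ⟨2 * i + 1, by omega, by omega, ?_⟩
    have h := gaussCoef_add_two_mul 0 (i + 1)
    rw [zero_add] at h
    rw [sphereCoef, show 2 * (i + 1) % 2 = 0 by omega, h,
      show 2 * (i + 1) = 2 * i + 1 + 1 by ring, Nat.factorial_eq_mul_doubleFactorial,
      show 2 * i + 1 + 1 + 0 + e = 2 * i + 1 + (e + 1) by ring]
    push_cast
    rw [mul_div_cancel_left₀ _ (hpos _)]
  · refine ⟨2 * j + 1, by omega, by omega, ?_⟩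
    have h := gaussCoef_add_two_mul 1 j
    rw [add_comm 1] at h
    rw [sphereCoef, show (2 * j + 1) % 2 = 1 by omega, h, Nat.factorial_eq_mul_doubleFactorial,
      show 2 * j + 1 + 1 + e = 2 * j + 1 + (e + 1) by ring]
    push_cast
    rw [mul_div_cancel_right₀ _ (hpos _)]

lemma rpow_neg_half_sq (e : ℕ) {p : ℝ} (hp : 0 < p) :
    (p ^ (-((e : ℝ) + 1) / 2)) ^ 2 = (1 / p) ^ (e + 1) := by
  rw [← Real.rpow_natCast, ← Real.rpow_mul hp.le, one_div, inv_pow, ← Real.rpow_natCast p,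
    ← Real.rpow_neg hp.le]
  congr 1; push_cast; ring

lemma sphereCoef_base_bounds (e : ℕ) : ∃ c C : ℝ, 0 < c ∧ 0 < C ∧ ∀ p : ℕ, 1 ≤ p →
    c * (p : ℝ) ^ (-((e : ℝ) + 1) / 2) ≤ sphereCoef e p (p % 2) ∧
    sphereCoef e p (p % 2) ≤ C * (p : ℝ) ^ (-((e : ℝ) + 1) / 2) := by
  have hA := sphereConst_pos e
  refine ⟨sphereConst e * √((1 / (2 * ((e : ℝ) + 2))) ^ (e + 1)), sphereConst e * √(2 ^ (e + 1)),
    by positivity, by positivity, fun p hp => ?_⟩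
  obtain ⟨q, h1, h2, h⟩ := sphereCoef_base e p hp
  obtain ⟨h3, h4⟩ := doubleFactorial_div_sq_bounds q (e + 1)
  have hp' : (1 : ℝ) ≤ p := by exact_mod_cast hp
  have hp0 : (0 : ℝ) < p := by linarith
  have h1' : (p : ℝ) ≤ q + 1 := by exact_mod_cast h1
  have h2' : (q : ℝ) ≤ p := by exact_mod_cast h2
  have he : (0 : ℝ) ≤ e := e.cast_nonneg
  have hq : (0 : ℝ) ≤ q := q.cast_nonneg
  have hr := rpow_neg_half_sq e hp0
  rw [h, mul_assoc, mul_assoc]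
  constructor
  · refine mul_le_mul_of_nonneg_left ((sq_le_sq₀ (by positivity) (by positivity)).1 ?_) hA.le
    rw [mul_pow, hr, Real.sq_sqrt (by positivity), ← mul_pow]
    refine le_trans ?_ h3
    rw [one_div (_ ^ _), ← inv_pow, ← one_div]
    refine pow_le_pow_left₀ (by positivity) ?_ _
    rw [div_mul_div_comm, one_mul]
    refine one_div_le_one_div_of_le (by positivity) ?_
    push_cast
    nlinarith
  · refine mul_le_mul_of_nonneg_left ((sq_le_sq₀ (by positivity) (by positivity)).1 ?_) hA.le
    rw [mul_pow, hr, Real.sq_sqrt (by positivity), ← mul_pow]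
    refine h4.trans (pow_le_pow_left₀ (by positivity) ?_ _)
    rw [mul_one_div]
    gcongr

/-- The ratio of consecutive scalars, in product form so that it also covers the range where both
sides vanish. -/
lemma sphereCoef_add_two (e p k : ℕ) :
    sphereCoef e p (k + 2) * ((p : ℝ) + k + 2 + e) = sphereCoef e p k * ((p : ℝ) - k) := by
  by_cases h : k ≤ p ∧ p % 2 = k % 2
  · obtain ⟨j, rfl⟩ := exists_eq_add_two_mul h
    rcases j with _ | j
    · rw [sphereCoef_eq_zero (by omega)]; simp
    · have h1 := gaussCoef_add_two_mul (k + 2) j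
      have h2 := gaussCoef_add_two_mul k (j + 1)
      rw [show k + 2 + 2 * j = k + 2 * (j + 1) by ring] at h1
      rw [sphereCoef, sphereCoef, h1, h2, show 2 * (j + 1) = 2 * j + 2 by ring,
        show k + (2 * j + 2) + (k + 2) + e = (k + (2 * j + 2) + k + e) + 2 by ring,
        Nat.doubleFactorial_add_two, Nat.doubleFactorial_add_two]
      have hd1 : ((2 * j).doubleFactorial : ℝ) ≠ 0 := by
        exact_mod_cast (Nat.doubleFactorial_pos _).ne'
      have hd2 : ((k + (2 * j + 2) + k + e).doubleFactorial : ℝ) ≠ 0 := by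
        exact_mod_cast (Nat.doubleFactorial_pos _).ne'
      have h3 : (k : ℝ) + (2 * j + 2) + k + e + 2 ≠ 0 := by positivity
      push_cast
      field_simp
      ring
  · rw [sphereCoef_eq_zero h, sphereCoef_eq_zero (by omega)]; simp

lemma sphereCoef_le (e : ℕ) : ∃ C : ℝ, 0 < C ∧ ∀ p k : ℕ, 1 ≤ p →
    sphereCoef e p k ≤
      C * (p : ℝ) ^ (-((e : ℝ) + 1) / 2) * Real.exp (-((k : ℝ) ^ 2 / (4 * p))) := by
  obtain ⟨_, C, _, hC, h⟩ := sphereCoef_base_bounds e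
  -- The factor `2` is spent at `k = 1`, where the Gaussian factor is already below `1`.
  refine ⟨2 * C, by positivity, fun p k hp => ?_⟩
  have hp' : (1 : ℝ) ≤ p := by exact_mod_cast hp
  have hX : 0 < (p : ℝ) ^ (-((e : ℝ) + 1) / 2) := by positivity
  have hCX := mul_pos hC hX
  induction k using Nat.twoStepInduction with
  | zero =>
    rcases Nat.mod_two_eq_zero_or_one p with h0 | h0
    · have := (h p hp).2
      rw [h0] at this
      simp only [Nat.cast_zero, ne_eq, OfNat.ofNat_ne_zero, not_false_eq_true, zero_pow, zero_div,
        neg_zero, Real.exp_zero, mul_one]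
      linarith
    · rw [sphereCoef_eq_zero (by omega)]; positivity
  | one =>
    rcases Nat.mod_two_eq_zero_or_one p with h0 | h0
    · rw [sphereCoef_eq_zero (by omega)]; positivity
    · have := (h p hp).2
      rw [h0] at this
      have h1 := Real.add_one_le_exp (-(((1 : ℕ) : ℝ) ^ 2 / (4 * p)))
      have h2 : (((1 : ℕ) : ℝ) ^ 2 / (4 * p)) ≤ 1 / 2 := by
        rw [div_le_div_iff₀ (by positivity) (by positivity)]; push_cast; linarith
      nlinarith
  | more k ih _ =>
    by_cases hk : k + 2 ≤ p
    · have hk' : (k : ℝ) + 2 ≤ p := by exact_mod_cast hk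
      have hk0 : (0 : ℝ) ≤ k := k.cast_nonneg
      have he0 : (0 : ℝ) ≤ e := e.cast_nonneg
      have hrec := sphereCoef_add_two e p k
      -- The right side is exactly the change of `exp(-k²/(4p))` from `k` to `k + 2`, since `(k+2)²
      -- - k² = 4(k+1)`.
      have hratio : ((p : ℝ) - k) / ((p : ℝ) + k + 2 + e) ≤ Real.exp (-((k + 1) / p)) := by
        have := Real.add_one_le_exp (-(((k : ℝ) + 1) / p))
        refine le_trans ?_ this
        have e1 : -(((k : ℝ) + 1) / p) + 1 = (p - (k + 1)) / p := by field_simp; ring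
        rw [e1, div_le_div_iff₀ (by positivity) (by positivity)]
        nlinarith [mul_nonneg hk0 he0, mul_nonneg he0 (by linarith : (0 : ℝ) ≤ p - k - 1)]
      have hmul : Real.exp (-((((k + 2 : ℕ) : ℝ)) ^ 2 / (4 * p))) =
          Real.exp (-((k : ℝ) ^ 2 / (4 * p))) * Real.exp (-((k + 1) / p)) := by
        rw [← Real.exp_add]; congr 1; push_cast; field_simp; ring
      rw [eq_div_of_mul_eq (by positivity) hrec, mul_div_assoc, hmul, ← mul_assoc]
      exact mul_le_mul ih hratio (div_nonneg (by linarith) (by positivity)) (by positivity)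
    · rw [sphereCoef_eq_zero (by omega)]; positivity

/-- Each ratio is at least `1 - (2k + 2 + e)/p`, and a product of such factors is at least one minus
the sum of the losses. The expression `k(k + e)/p` grows by twice the loss at each step, which
leaves slack. -/
lemma le_sphereCoef_aux (e : ℕ) : ∃ c : ℝ, 0 < c ∧ ∀ p k : ℕ, 1 ≤ p → p % 2 = k % 2 →
    c * (p : ℝ) ^ (-((e : ℝ) + 1) / 2) * (1 - k * (k + e) / p) ≤ sphereCoef e p k := by
  obtain ⟨c, _, hc, _, h⟩ := sphereCoef_base_bounds e
  refine ⟨c, hc, fun p k hp => ?_⟩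
  have hp' : (1 : ℝ) ≤ p := by exact_mod_cast hp
  have hX : 0 < (p : ℝ) ^ (-((e : ℝ) + 1) / 2) := by positivity
  have hcX := mul_pos hc hX
  have he0 : (0 : ℝ) ≤ e := e.cast_nonneg
  induction k using Nat.twoStepInduction with
  | zero =>
    intro h0
    have := (h p hp).1
    rw [h0] at this
    simpa using this
  | one =>
    intro h0
    have h1 := (h p hp).1
    rw [h0] at h1
    refine le_trans (mul_le_of_le_one_right hcX.le ?_) h1
    have : 0 ≤ ((1 : ℕ) : ℝ) * (((1 : ℕ) : ℝ) + e) / p := by positivity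
    linarith
  | more k ih _ =>
    intro h0
    have ih := ih (by omega)
    have hk0 : (0 : ℝ) ≤ k := k.cast_nonneg
    push_cast
    by_cases hneg : 1 - ((k : ℝ) + 2) * (k + 2 + e) / p ≤ 0
    · exact (mul_nonpos_of_nonneg_of_nonpos hcX.le hneg).trans (sphereCoef_nonneg e p _)
    · have hlt : ((k : ℝ) + 2) * (k + 2 + e) < p := by
        have : ((k : ℝ) + 2) * (k + 2 + e) / p < 1 := by linarith
        rwa [div_lt_one (by linarith)] at this
      have hrec := sphereCoef_add_two e p k
      have hr : 1 - (2 * k + 2 + e) / p ≤ ((p : ℝ) - k) / ((p : ℝ) + k + 2 + e) := by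
        have e1 : 1 - (2 * (k : ℝ) + 2 + e) / p = (p - (2 * k + 2 + e)) / p := by field_simp
        rw [e1, div_le_div_iff₀ (by positivity) (by positivity)]
        nlinarith [mul_nonneg hk0 he0, mul_nonneg hk0 hk0, mul_nonneg he0 he0]
      have h1 : 0 ≤ 1 - (2 * (k : ℝ) + 2 + e) / p := by
        rw [sub_nonneg, div_le_one (by linarith)]; nlinarith
      have e2 : sphereCoef e p (k + 2) =
          sphereCoef e p k * (((p : ℝ) - k) / ((p : ℝ) + k + 2 + e)) := by
        rw [eq_div_of_mul_eq (by positivity) hrec, mul_div_assoc]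
      rw [e2]
      calc _ ≤ c * (p : ℝ) ^ (-((e : ℝ) + 1) / 2) *
            ((1 - k * (k + e) / p) * (1 - (2 * k + 2 + e) / p)) := by
            refine mul_le_mul_of_nonneg_left ?_ hcX.le
            have a1 : 0 ≤ (k : ℝ) * (k + e) / p := by positivity
            have a2 : 0 ≤ (2 * (k : ℝ) + 2 + e) / p := by positivity
            have a3 : ((k : ℝ) + 2) * (k + 2 + e) / p =
                k * (k + e) / p + (2 * k + 2 + e) / p + (2 * k + 2 + e) / p := by
              field_simp; ring
            rw [a3]
            nlinarith [mul_nonneg a1 a2]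
        _ = c * (p : ℝ) ^ (-((e : ℝ) + 1) / 2) * (1 - k * (k + e) / p) *
            (1 - (2 * k + 2 + e) / p) := by ring
        _ ≤ sphereCoef e p k * (1 - (2 * k + 2 + e) / p) := mul_le_mul_of_nonneg_right ih h1
        _ ≤ _ := mul_le_mul_of_nonneg_left hr (sphereCoef_nonneg e p k)

lemma le_sphereCoef (e : ℕ) : ∃ c : ℝ, 0 < c ∧ ∀ p k : ℕ, 1 ≤ k → p % 2 = k % 2 →
    2 * (e + 1) * k ^ 2 ≤ p → c * (p : ℝ) ^ (-((e : ℝ) + 1) / 2) ≤ sphereCoef e p k := by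
  obtain ⟨c, hc, h⟩ := le_sphereCoef_aux e
  refine ⟨c / 2, by positivity, fun p k hk hpar hp => ?_⟩
  have hk1 : (1 : ℝ) ≤ k := by exact_mod_cast hk
  have he0 : (0 : ℝ) ≤ e := e.cast_nonneg
  have hp' : 2 * ((e : ℝ) + 1) * k ^ 2 ≤ p := by exact_mod_cast hp
  have hp0 : (0 : ℝ) < p := lt_of_lt_of_le (by positivity) hp'
  refine le_trans ?_ (h p k (by exact_mod_cast hp0) hpar)
  have h1 : (k : ℝ) * (k + e) / p ≤ 1 / 2 := by
    rw [div_le_div_iff₀ hp0 (by norm_num)]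
    nlinarith [mul_nonneg he0 (by nlinarith : (0 : ℝ) ≤ (k : ℝ) ^ 2 - k)]
  have hX : 0 < (p : ℝ) ^ (-((e : ℝ) + 1) / 2) := by positivity
  nlinarith [mul_pos hc hX]

/-- On the diagonal the numerator is `k! = 2^(-k) (2k)‼`, so only a ratio of double factorials `e`
apart remains. -/
lemma le_sphereCoef_diag (e : ℕ) : ∃ c : ℝ, 0 < c ∧ ∀ k : ℕ, 1 ≤ k →
    c * (k : ℝ) ^ (-(e : ℝ) / 2) * (2 : ℝ) ^ (-(k : ℝ)) ≤ sphereCoef e k k := by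
  have hA := sphereConst_pos e
  have he0 : (0 : ℝ) ≤ e := e.cast_nonneg
  refine ⟨sphereConst e * √((1 / (2 * ((e : ℝ) + 2))) ^ e), by positivity, fun k hk => ?_⟩
  have hk1 : (1 : ℝ) ≤ k := by exact_mod_cast hk
  have hk0 : (0 : ℝ) < k := by linarith
  obtain ⟨h3, -⟩ := doubleFactorial_div_sq_bounds (2 * k) e
  have hd : ((k.factorial : ℕ) : ℝ) ≠ 0 := by exact_mod_cast (Nat.factorial_pos _).ne'
  have e1 : sphereCoef e k k = sphereConst e *
      (((2 * k).doubleFactorial : ℝ) / ((2 * k + e).doubleFactorial : ℝ)) * (2 : ℝ) ^ (-(k : ℝ)) := by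
    have := gaussCoef_add_two_mul k 0
    simp only [mul_zero, add_zero, Nat.doubleFactorial, Nat.cast_one, div_one] at this
    rw [sphereCoef, this, Nat.doubleFactorial_two_mul, Real.rpow_neg (by norm_num),
      Real.rpow_natCast, show k + k + e = 2 * k + e by ring]
    push_cast
    field_simp
  rw [e1]
  refine mul_le_mul_of_nonneg_right ?_ (by positivity)
  rw [mul_assoc]
  refine mul_le_mul_of_nonneg_left ((sq_le_sq₀ (by positivity) (by positivity)).1 ?_) hA.le
  have hr : ((k : ℝ) ^ (-(e : ℝ) / 2)) ^ 2 = (1 / (k : ℝ)) ^ e := by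
    rw [← Real.rpow_natCast, ← Real.rpow_mul hk0.le, one_div, inv_pow, ← Real.rpow_natCast (k : ℝ),
      ← Real.rpow_neg hk0.le]
    congr 1; push_cast; ring
  rw [mul_pow, hr, Real.sq_sqrt (by positivity), ← mul_pow]
  refine le_trans ?_ h3
  rw [one_div (_ ^ _), ← inv_pow, ← one_div]
  refine pow_le_pow_left₀ (by positivity) ?_ _
  rw [div_mul_div_comm, one_mul]
  refine one_div_le_one_div_of_le (by positivity) ?_
  push_cast
  nlinarith

/-! ### Heat-kernel type sums -/

lemma sum_rpow_neg_tail_le {b : ℝ} (hb : 1 < b) {m : ℕ} (hm : 1 ≤ m) (n : ℕ) :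
    ∑ i ∈ Finset.range n, ((i + (m + 1) : ℕ) : ℝ) ^ (-b) ≤
      ((m : ℝ) ^ (1 - b) - ((n + m : ℕ) : ℝ) ^ (1 - b)) / (b - 1) := by
  induction n with
  | zero => simp
  | succ n ih =>
    rw [Finset.sum_range_succ]
    have hN : (0 : ℝ) < ((n + m : ℕ) : ℝ) := by exact_mod_cast (by omega : 0 < n + m)
    rw [show n + (m + 1) = (n + m) + 1 by ring, show n + 1 + m = (n + m) + 1 by ring]
    set N : ℝ := ((n + m : ℕ) : ℝ)
    have hcast : (((n + m) + 1 : ℕ) : ℝ) = N + 1 := by push_cast; simp [N]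
    rw [hcast]
    have hX : 0 < (N + 1) ^ (1 - b) := by positivity
    -- A Bernoulli inequality for `(N / (N + 1)) ^ (1 - b)`; it replaces comparison with an integral
    -- and makes the sum telescope.
    have key : (N + 1) ^ (1 - b) * (1 + (b - 1) / (N + 1)) ≤ N ^ (1 - b) := by
      have h1 : N ^ (1 - b) = (N + 1) ^ (1 - b) * (N / (N + 1)) ^ (1 - b) := by
        rw [← Real.mul_rpow (by positivity) (by positivity)]
        congr 1; field_simp
      rw [h1]
      refine mul_le_mul_of_nonneg_left ?_ hX.le
      have hlog := Real.log_le_sub_one_of_pos (x := N / (N + 1)) (by positivity)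
      rw [Real.rpow_def_of_pos (by positivity)]
      have h2 := Real.add_one_le_exp (Real.log (N / (N + 1)) * (1 - b))
      have h3 : N / (N + 1) - 1 = -(1 / (N + 1)) := by field_simp; ring
      rw [h3] at hlog
      have h4 : (b - 1) / (N + 1) = (b - 1) * (1 / (N + 1)) := by ring
      rw [h4]
      nlinarith
    have hmul : (N + 1) ^ (-b) = (N + 1) ^ (1 - b) / (N + 1) := by
      rw [← Real.rpow_sub_one (by positivity)]; congr 1; ring
    have hstep : (N + 1) ^ (-b) ≤ (N ^ (1 - b) - (N + 1) ^ (1 - b)) / (b - 1) := by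
      rw [le_div_iff₀ (by linarith), hmul]
      have : (N + 1) ^ (1 - b) / (N + 1) * (b - 1) =
        (N + 1) ^ (1 - b) * (1 + (b - 1) / (N + 1)) - (N + 1) ^ (1 - b) := by ring
      linarith
    calc _ ≤ _ := add_le_add ih hstep
      _ = _ := by ring

/-- Raise `u ≤ exp u` to the power `b` at `u = κ / (4pb)`; the bound is uniform in `p`. -/
lemma rpow_neg_mul_exp_le {b : ℝ} (hb : 0 < b) {p κ : ℝ} (hp : 0 < p) (hκ : 0 < κ) :
    p ^ (-b) * Real.exp (-(κ / (4 * p))) ≤ (4 * b) ^ b * κ ^ (-b) := by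
  have h1 : (κ / (4 * p) / b) ^ b ≤ Real.exp (κ / (4 * p)) := by
    have h2 : κ / (4 * p) / b ≤ Real.exp (κ / (4 * p) / b) := by
      linarith [Real.add_one_le_exp (κ / (4 * p) / b)]
    calc _ ≤ (Real.exp (κ / (4 * p) / b)) ^ b := by gcongr
      _ = _ := by rw [← Real.exp_mul]; congr 1; field_simp
  have h3 : κ / (4 * p) / b = κ * (p⁻¹ * (4 * b)⁻¹) := by field_simp
  rw [h3, Real.mul_rpow hκ.le (by positivity), Real.mul_rpow (by positivity) (by positivity),
    Real.inv_rpow hp.le, Real.inv_rpow (by positivity)] at h1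
  rw [Real.rpow_neg hp.le, Real.rpow_neg hκ.le, Real.exp_neg, ← div_eq_mul_inv, ← div_eq_mul_inv,
    div_le_div_iff₀ (Real.exp_pos _) (by positivity)]
  have h5 : 0 < (4 * b) ^ b := by positivity
  calc (p ^ b)⁻¹ * κ ^ b = (4 * b) ^ b * (κ ^ b * ((p ^ b)⁻¹ * ((4 * b) ^ b)⁻¹)) := by
        field_simp
    _ ≤ _ := by gcongr

lemma tsum_rpow_mul_exp_le {b : ℝ} (hb : 1 < b) : ∃ C : ℝ, ∀ k : ℕ, 1 ≤ k →
    (Summable fun p : ℕ => (p : ℝ) ^ (-b) * Real.exp (-((k : ℝ) ^ 2 / (4 * p)))) ∧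
    ∑' p : ℕ, (p : ℝ) ^ (-b) * Real.exp (-((k : ℝ) ^ 2 / (4 * p))) ≤
      C * ((k : ℝ) ^ 2) ^ (1 - b) := by
  refine ⟨2 * (4 * b) ^ b + 1 / (b - 1), fun k hk => ?_⟩
  have hk1 : (1 : ℝ) ≤ k := by exact_mod_cast hk
  have hκ : (1 : ℝ) ≤ (k : ℝ) ^ 2 := by nlinarith
  have hle (p : ℕ) : (p : ℝ) ^ (-b) * Real.exp (-((k : ℝ) ^ 2 / (4 * p))) ≤ (p : ℝ) ^ (-b) := by
    refine mul_le_of_le_one_right (by positivity) (Real.exp_le_one_iff.2 ?_)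
    have : 0 ≤ (k : ℝ) ^ 2 / (4 * p) := by positivity
    linarith
  have hsb : Summable fun p : ℕ => (p : ℝ) ^ (-b) := Real.summable_nat_rpow.2 (by linarith)
  have hs : Summable fun p : ℕ => (p : ℝ) ^ (-b) * Real.exp (-((k : ℝ) ^ 2 / (4 * p))) :=
    hsb.of_nonneg_of_le (fun p => by positivity) hle
  refine ⟨hs, ?_⟩
  -- Split at the diffusive scale `p = k²`: below it every term is at most a constant times
  -- `(k²)^(-b)` and there are `k² + 1 ≤ 2k²` of them; above it the exponential is dropped.
  rw [← hs.sum_add_tsum_nat_add (k ^ 2 + 1), add_mul]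
  refine add_le_add ?_ ?_
  · have h1 (p : ℕ) : (p : ℝ) ^ (-b) * Real.exp (-((k : ℝ) ^ 2 / (4 * p))) ≤
        (4 * b) ^ b * ((k : ℝ) ^ 2) ^ (-b) := by
      rcases Nat.eq_zero_or_pos p with rfl | hp
      · rw [Nat.cast_zero, Real.zero_rpow (by linarith), zero_mul]; positivity
      · exact rpow_neg_mul_exp_le (by linarith) (by exact_mod_cast hp) (by linarith)
    refine (Finset.sum_le_card_nsmul _ _ _ fun p _ => h1 p).trans ?_
    rw [Finset.card_range, nsmul_eq_mul, show 1 - b = -b + 1 by ring,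
      Real.rpow_add_one (by positivity)]
    push_cast
    have : 0 < (4 * b) ^ b * ((k : ℝ) ^ 2) ^ (-b) := by positivity
    nlinarith
  · refine Real.tsum_le_of_sum_range_le (fun p => by positivity) fun n => ?_
    refine (Finset.sum_le_sum fun i _ => hle _).trans ((sum_rpow_neg_tail_le hb (by nlinarith) n).trans ?_)
    rw [div_mul_eq_mul_div, one_mul]
    push_cast
    refine div_le_div_of_nonneg_right ?_ (by linarith)
    have : 0 ≤ ((n : ℝ) + (k : ℝ) ^ 2) ^ (1 - b) := by positivity
    linarith

/-! ### The eigenvalues of the kernel -/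

lemma summable_mul_sphereCoef (e : ℕ) (c : ℕ → ℝ) (hc : ∀ p, 0 ≤ c p)
    (hs : Summable fun p : ℕ => c p * (p : ℝ) ^ (-((e : ℝ) + 1) / 2)) :
    Summable fun p => c p * sphereCoef e (2 * (p / 2)) 0 := by
  obtain ⟨C, hC, h⟩ := sphereCoef_le e
  have he0 : (0 : ℝ) ≤ e := e.cast_nonneg
  refine summable_of_isBigO_nat hs
    (IsBigO.of_bound (C * (1 / 2) ^ (-((e : ℝ) + 1) / 2)) (eventually_atTop.2 ⟨2, fun p hp => ?_⟩))
  have h1 := h (2 * (p / 2)) 0 (by omega)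
  have hp0 : (0 : ℝ) < p := by exact_mod_cast (by omega : 0 < p)
  rw [Real.norm_of_nonneg (mul_nonneg (hc p) (sphereCoef_nonneg _ _ _)),
    Real.norm_of_nonneg (mul_nonneg (hc p) (by positivity)), mul_left_comm]
  refine mul_le_mul_of_nonneg_left (h1.trans ?_) (hc p)
  simp only [Nat.cast_zero, ne_eq, OfNat.ofNat_ne_zero, not_false_eq_true, zero_pow, zero_div,
        neg_zero, Real.exp_zero, mul_one]
  rw [mul_assoc, ← Real.mul_rpow (by norm_num) hp0.le]
  refine mul_le_mul_of_nonneg_left ?_ hC.le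
  refine Real.rpow_le_rpow_of_nonpos (by positivity) ?_ (by linarith)
  have : p ≤ 2 * (2 * (p / 2)) := by omega
  have : (p : ℝ) ≤ 2 * ((2 * (p / 2) : ℕ) : ℝ) := by exact_mod_cast this
  linarith

lemma summable_mul_sphereCoef_of_summable (e : ℕ) (c : ℕ → ℝ) (hc : ∀ p, 0 ≤ c p)
    (hs : Summable c) : Summable fun p => c p * sphereCoef e (2 * (p / 2)) 0 := by
  have he0 : (0 : ℝ) ≤ e := e.cast_nonneg
  refine summable_mul_sphereCoef e c hc (hs.of_nonneg_of_le (fun p => mul_nonneg (hc p) (by positivity))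
    fun p => mul_le_of_le_one_right (hc p) ?_)
  rcases Nat.eq_zero_or_pos p with rfl | hp
  · rw [Nat.cast_zero, Real.zero_rpow (by linarith)]; norm_num
  · exact Real.rpow_le_one_of_one_le_of_nonpos (by exact_mod_cast hp) (by linarith)

lemma isBigO_eigenvalue_of_power_law (e : ℕ) (c : ℕ → ℝ) (hc : ∀ p, 0 ≤ c p) {a C : ℝ}
    (ha : 1 - ((e : ℝ) + 1) / 2 < a) (hC : 0 < C) (h : ∀ᶠ p : ℕ in atTop, c p ≤ C * (p : ℝ) ^ (-a)) :
    (fun k => ∑' p, c p * sphereCoef e p k) =O[atTop]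
      (fun k : ℕ => (k : ℝ) ^ (-((e : ℝ) + 1) - 2 * a + 2)) := by
  obtain ⟨C2, hC2, h2⟩ := sphereCoef_le e
  obtain ⟨C3, h3⟩ := tsum_rpow_mul_exp_le (b := a + ((e : ℝ) + 1) / 2) (by linarith)
  obtain ⟨N, hN⟩ := eventually_atTop.1 h
  refine IsBigO.of_bound (C * C2 * C3) (eventually_atTop.2 ⟨max N 1, fun k hk => ?_⟩)
  have hkN : N ≤ k := (le_max_left _ _).trans hk
  have hk1 : 1 ≤ k := (le_max_right _ _).trans hk
  have hk0 : (0 : ℝ) < k := by exact_mod_cast hk1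
  obtain ⟨hs, hle⟩ := h3 k hk1
  have hterm (p : ℕ) : c p * sphereCoef e p k ≤ C * C2 *
      ((p : ℝ) ^ (-(a + ((e : ℝ) + 1) / 2)) * Real.exp (-((k : ℝ) ^ 2 / (4 * p)))) := by
    -- Terms with `p < k` vanish, so for `k ≥ N` the eventual bound on `c` covers every term that
    -- matters.
    by_cases hp : k ≤ p
    · have hp0 : (0 : ℝ) < p := by exact_mod_cast (by omega : 0 < p)
      calc c p * sphereCoef e p k ≤ (C * (p : ℝ) ^ (-a)) *
            (C2 * (p : ℝ) ^ (-((e : ℝ) + 1) / 2) * Real.exp (-((k : ℝ) ^ 2 / (4 * p)))) :=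
            mul_le_mul (hN p (by omega)) (h2 p k (by omega)) (sphereCoef_nonneg _ _ _)
              (by positivity)
        _ = _ := by
            rw [show -(a + ((e : ℝ) + 1) / 2) = -a + -((e : ℝ) + 1) / 2 by ring,
              Real.rpow_add hp0]
            ring
    · rw [sphereCoef_eq_zero (by omega), mul_zero]; positivity
  have hnn (p : ℕ) : 0 ≤ c p * sphereCoef e p k := mul_nonneg (hc p) (sphereCoef_nonneg _ _ _)
  rw [Real.norm_of_nonneg (tsum_nonneg hnn), Real.norm_of_nonneg (by positivity)]
  have hs' := hs.mul_left (C * C2)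
  refine ((hs'.of_nonneg_of_le hnn hterm).tsum_le_tsum hterm hs').trans ?_
  rw [tsum_mul_left, mul_assoc (C * C2)]
  refine mul_le_mul_of_nonneg_left (hle.trans_eq ?_) (by positivity)
  rw [← Real.rpow_natCast, ← Real.rpow_mul hk0.le]
  congr 2
  push_cast
  ring

/-- About `k²` indices `p` of size `k²` already give the right order. The predicate `S`, stable
under even shifts, lets one argument serve all, even or odd indices. -/
lemma eigenvalue_ge_of_power_law (e : ℕ) (c : ℕ → ℝ) (hc : ∀ p, 0 ≤ c p) {a C : ℝ}
    (ha : 1 - ((e : ℝ) + 1) / 2 < a) (hC : 0 < C) {S : ℕ → Prop} (hS : ∀ k j, S k → S (k + 2 * j))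
    (h : ∀ᶠ p : ℕ in atTop, S p → C * (p : ℝ) ^ (-a) ≤ c p)
    (hs : ∀ k, Summable fun p => c p * sphereCoef e p k) :
    (fun k : ℕ => (k : ℝ) ^ (-((e : ℝ) + 1) - 2 * a + 2)) =O[atTop ⊓ 𝓟 {k | S k}]
      (fun k => ∑' p, c p * sphereCoef e p k) := by
  obtain ⟨C2, hC2, h2⟩ := le_sphereCoef e
  obtain ⟨N, hN⟩ := eventually_atTop.1 h
  set b := a + ((e : ℝ) + 1) / 2 with hb
  have hb1 : 1 < b := by linarith
  set M := 2 * (e + 1) with hM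
  have hMpos : 0 < M := by omega
  have hM0 : (0 : ℝ) < M := by exact_mod_cast hMpos
  have hD : 0 < C * C2 * (5 * (M : ℝ)) ^ (-b) * M := by positivity
  refine IsBigO.of_bound (C * C2 * (5 * (M : ℝ)) ^ (-b) * M)⁻¹ (eventually_inf_principal.2
    (eventually_atTop.2 ⟨max N 1, fun k hk hSk => ?_⟩))
  have hkN : N ≤ k := (le_max_left _ _).trans hk
  have hk1 : 1 ≤ k := (le_max_right _ _).trans hk
  have hk0 : (0 : ℝ) < k := by exact_mod_cast hk1
  have hnn (p : ℕ) : 0 ≤ c p * sphereCoef e p k := mul_nonneg (hc p) (sphereCoef_nonneg _ _ _)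
  rw [Real.norm_of_nonneg (tsum_nonneg hnn), Real.norm_of_nonneg (by positivity), inv_mul_eq_div,
    le_div_iff₀ hD]
  have hinj : Function.Injective fun j : ℕ => k + 2 * j := fun i j hij => by
    simp only at hij; omega
  -- For these `M k²` values of `j`, the index `k + 2j` exceeds the threshold `M k²` of
  -- `le_sphereCoef` and stays below `5 M k²`.
  have hterm : ∀ j ∈ Finset.Ico (M * k ^ 2) (2 * (M * k ^ 2)),
      C * C2 * (5 * (M : ℝ)) ^ (-b) * ((k : ℝ) ^ 2) ^ (-b) ≤
        c (k + 2 * j) * sphereCoef e (k + 2 * j) k := by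
    intro j hj
    rw [Finset.mem_Ico] at hj
    have hkk : k ≤ M * k ^ 2 := by nlinarith
    have hp0 : (0 : ℝ) < ((k + 2 * j : ℕ) : ℝ) := by exact_mod_cast (by omega : 0 < k + 2 * j)
    have hp5 : ((k + 2 * j : ℕ) : ℝ) ≤ 5 * M * (k : ℝ) ^ 2 := by
      have : k + 2 * j ≤ 5 * (M * k ^ 2) := by omega
      have : ((k + 2 * j : ℕ) : ℝ) ≤ 5 * (M * k ^ 2) := by exact_mod_cast this
      linarith
    calc _ = C * C2 * (5 * M * (k : ℝ) ^ 2) ^ (-b) := by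
          rw [Real.mul_rpow (x := 5 * (M : ℝ)) (by positivity) (by positivity)]; ring
      _ ≤ C * C2 * ((k + 2 * j : ℕ) : ℝ) ^ (-b) := by
          refine mul_le_mul_of_nonneg_left ?_ (by positivity)
          exact Real.rpow_le_rpow_of_nonpos hp0 hp5 (by linarith)
      _ = (C * ((k + 2 * j : ℕ) : ℝ) ^ (-a)) *
          (C2 * ((k + 2 * j : ℕ) : ℝ) ^ (-((e : ℝ) + 1) / 2)) := by
          rw [hb, show -(a + ((e : ℝ) + 1) / 2) = -a + -((e : ℝ) + 1) / 2 by ring,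
            Real.rpow_add hp0]
          ring
      _ ≤ _ := by
          refine mul_le_mul (hN _ (by omega) (hS k j hSk)) (h2 _ k hk1 (by omega) ?_)
            (by positivity) (hc _)
          omega
  refine le_trans ?_ ((hs k).sum_le_tsum ((Finset.Ico (M * k ^ 2) (2 * (M * k ^ 2))).map
    ⟨fun j => k + 2 * j, hinj⟩) fun p _ => hnn p)
  rw [Finset.sum_map]
  refine le_trans ?_ (Finset.card_nsmul_le_sum _ _ _ hterm)
  rw [Nat.card_Ico, show 2 * (M * k ^ 2) - M * k ^ 2 = M * k ^ 2 by omega, nsmul_eq_mul]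
  have hpow : (k : ℝ) ^ (-((e : ℝ) + 1) - 2 * a + 2) = ((k : ℝ) ^ 2) ^ (-b) * (k : ℝ) ^ 2 := by
    rw [← Real.rpow_add_one (by positivity), ← Real.rpow_natCast, ← Real.rpow_mul hk0.le, hb]
    congr 1
    push_cast
    ring
  rw [hpow]
  push_cast
  exact le_of_eq (by ring)

/-! ### Stretched-exponential coefficients -/

lemma sphereCoef_le_exp (e : ℕ) : ∃ C : ℝ, 0 < C ∧ ∀ p k : ℕ, 1 ≤ p →
    sphereCoef e p k ≤ C * Real.exp (-((k : ℝ) ^ 2 / (4 * p))) := by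
  obtain ⟨C, hC, h⟩ := sphereCoef_le e
  refine ⟨C, hC, fun p k hp => (h p k hp).trans ?_⟩
  have he0 : (0 : ℝ) ≤ e := e.cast_nonneg
  refine mul_le_mul_of_nonneg_right (mul_le_of_le_one_right hC.le ?_) (Real.exp_pos _).le
  exact Real.rpow_le_one_of_one_le_of_nonpos (by exact_mod_cast hp) (by linarith)

lemma exp_neg_le_factorial_div_pow {u : ℝ} (hu : 0 < u) (n : ℕ) :
    Real.exp (-u) ≤ n.factorial / u ^ n := by
  have h := Real.pow_div_factorial_le_exp u hu.le n
  have hn : (0 : ℝ) < n.factorial := by exact_mod_cast n.factorial_pos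
  rw [Real.exp_neg, inv_eq_one_div, div_le_div_iff₀ (Real.exp_pos _) (by positivity), one_mul]
  rwa [div_le_iff₀ hn, mul_comm] at h

lemma summable_exp_neg_mul_sqrt {a : ℝ} (ha : 0 < a) :
    Summable fun p : ℕ => Real.exp (-a * √(p : ℝ)) := by
  refine summable_of_isBigO_nat (Real.summable_nat_pow_inv.2 (by norm_num : 1 < 2))
    (IsBigO.of_bound (24 / a ^ 4) (eventually_atTop.2 ⟨1, fun p hp => ?_⟩))
  have hp0 : (0 : ℝ) < p := by exact_mod_cast hp
  rw [Real.norm_of_nonneg (Real.exp_pos _).le, Real.norm_of_nonneg (by positivity), neg_mul]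
  refine (exp_neg_le_factorial_div_pow (by positivity) 4).trans_eq ?_
  rw [mul_pow, show √(p : ℝ) ^ 4 = (√(p : ℝ) ^ 2) ^ 2 by ring, Real.sq_sqrt hp0.le]
  norm_num [Nat.factorial]
  field_simp

lemma isBigO_eigenvalue_of_stretched_exp (e : ℕ) (c : ℕ → ℝ) (hc : ∀ p, 0 ≤ c p) {a C : ℝ}
    (ha : 0 < a) (hC : 0 < C) (h : ∀ᶠ p : ℕ in atTop, c p ≤ C * Real.exp (-a * √(p : ℝ))) :
    (fun k => ∑' p, c p * sphereCoef e p k) =O[atTop]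
      (fun k : ℕ => (k : ℝ) ^ (-((e : ℝ) + 1) + 1 / 2) * Real.exp (-a * √(k : ℝ))) := by
  obtain ⟨C2, hC2, h2⟩ := sphereCoef_le_exp e
  obtain ⟨N, hN⟩ := eventually_atTop.1 h
  have hs := summable_exp_neg_mul_sqrt (a := a / 4) (by positivity)
  set T := ∑' p : ℕ, Real.exp (-(a / 4) * √(p : ℝ)) with hT
  have hT0 : 0 ≤ T := tsum_nonneg fun p => (Real.exp_pos _).le
  set D : ℝ := ((2 * (e + 1)).factorial : ℝ) / (a / 2) ^ (2 * (e + 1)) with hD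
  have hD0 : 0 < D := by positivity
  obtain ⟨N2, hN2⟩ := exists_nat_ge ((24 * a) ^ 2)
  refine IsBigO.of_bound (C * C2 * T * D) (eventually_atTop.2 ⟨max N (max 1 N2), fun k hk => ?_⟩)
  have hkN : N ≤ k := (le_max_left _ _).trans hk
  have hk1 : 1 ≤ k := (le_max_left _ _).trans ((le_max_right _ _).trans hk)
  have hk2 : N2 ≤ k := (le_max_right _ _).trans ((le_max_right _ _).trans hk)
  have hk1' : (1 : ℝ) ≤ k := by exact_mod_cast hk1
  have hk0 : (0 : ℝ) < k := by linarith
  have hsk : 24 * a ≤ √(k : ℝ) := Real.le_sqrt_of_sq_le (hN2.trans (by exact_mod_cast hk2))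
  have hsq : √(k : ℝ) ^ 2 = k := Real.sq_sqrt hk0.le
  -- If `p ≥ 4k` then `√p ≥ 2√k` suffices; if `k ≤ p < 4k` then `k²/(4p) ≥ k/16 ≥ (3/2) a √k`, which
  -- is why `√k ≥ 24a` is required. Either way `exp(-(a/4)√p)` is left for summation over `p`, and
  -- the surplus `exp(-(a/2)√k)` later absorbs the power of `k`.
  have hterm (p : ℕ) : c p * sphereCoef e p k ≤
      C * C2 * Real.exp (-(3 / 2 * a * √(k : ℝ))) * Real.exp (-(a / 4) * √(p : ℝ)) := by
    by_cases hp : k ≤ p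
    · have hp' : (k : ℝ) ≤ p := by exact_mod_cast hp
      have hp0 : (0 : ℝ) < p := by linarith
      refine (mul_le_mul (hN p (by omega)) (h2 p k (by omega)) (sphereCoef_nonneg _ _ _)
        (by positivity)).trans ?_
      rw [mul_mul_mul_comm, ← Real.exp_add, mul_assoc (C * C2), ← Real.exp_add]
      refine mul_le_mul_of_nonneg_left (Real.exp_le_exp.2 ?_) (by positivity)
      have hu : 0 ≤ (k : ℝ) ^ 2 / (4 * p) := by positivity
      by_cases h4 : 4 * (k : ℝ) ≤ p
      · have : 2 * √(k : ℝ) ≤ √(p : ℝ) := by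
          refine Real.le_sqrt_of_sq_le ?_
          rw [mul_pow, hsq]; linarith
        nlinarith
      · have h5 : (k : ℝ) / 16 ≤ (k : ℝ) ^ 2 / (4 * p) := by
          rw [div_le_div_iff₀ (by norm_num) (by positivity)]
          nlinarith
        have h6 : 24 * a * √(k : ℝ) ≤ k := by
          nlinarith [Real.sqrt_nonneg (k : ℝ)]
        have h7 := mul_nonneg ha.le (Real.sqrt_nonneg (p : ℝ))
        nlinarith
    · rw [sphereCoef_eq_zero (by omega), mul_zero]; positivity
  have hnn (p : ℕ) : 0 ≤ c p * sphereCoef e p k := mul_nonneg (hc p) (sphereCoef_nonneg _ _ _)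
  rw [Real.norm_of_nonneg (tsum_nonneg hnn), Real.norm_of_nonneg (by positivity)]
  have hs' := hs.mul_left (C * C2 * Real.exp (-(3 / 2 * a * √(k : ℝ))))
  refine ((hs'.of_nonneg_of_le hnn hterm).tsum_le_tsum hterm hs').trans ?_
  rw [tsum_mul_left, ← hT]
  have h8 : Real.exp (-(3 / 2 * a * √(k : ℝ))) =
      Real.exp (-(a / 2 * √(k : ℝ))) * Real.exp (-a * √(k : ℝ)) := by
    rw [← Real.exp_add]; congr 1; ring
  have h9 : Real.exp (-(a / 2 * √(k : ℝ))) ≤ D * (k : ℝ) ^ (-((e : ℝ) + 1) + 1 / 2) := by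
    refine (exp_neg_le_factorial_div_pow (by positivity) (2 * (e + 1))).trans ?_
    rw [mul_pow, pow_mul √(k : ℝ), hsq, ← div_div, ← hD, div_eq_mul_inv]
    refine mul_le_mul_of_nonneg_left ?_ hD0.le
    rw [← Real.rpow_natCast, ← Real.rpow_neg hk0.le]
    refine Real.rpow_le_rpow_of_exponent_le hk1' ?_
    push_cast
    linarith
  calc _ = C * C2 * T * (Real.exp (-(a / 2 * √(k : ℝ))) * Real.exp (-a * √(k : ℝ))) := by
        rw [h8]; ring
    _ ≤ C * C2 * T * (D * (k : ℝ) ^ (-((e : ℝ) + 1) + 1 / 2) * Real.exp (-a * √(k : ℝ))) := by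
        gcongr
    _ = _ := by ring

/-! ### Geometric coefficients -/

lemma summable_succ_pow_mul_geometric (n : ℕ) {r : ℝ} (h0 : 0 < r) (h1 : r < 1) :
    Summable fun m : ℕ => ((m : ℝ) + 1) ^ n * r ^ m := by
  have h := (summable_nat_add_iff 1).2 (summable_pow_mul_geometric_of_norm_lt_one n
    (r := r) (by rwa [Real.norm_of_nonneg h0.le]))
  refine (h.mul_left r⁻¹).congr fun m => ?_
  push_cast
  rw [pow_succ]
  field_simp

lemma rpow_half_mul_le {a : ℝ} (ha : 1 < a) (p : ℕ) :
    (p : ℝ) ^ (1 / 2 : ℝ) * a ^ (-(p : ℝ)) ≤ ((p : ℝ) + 1) * (a⁻¹) ^ p := by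
  have hp0 : (0 : ℝ) ≤ p := p.cast_nonneg
  rw [Real.rpow_neg (by linarith), Real.rpow_natCast, inv_pow]
  refine mul_le_mul_of_nonneg_right ?_ (by positivity)
  calc (p : ℝ) ^ (1 / 2 : ℝ) ≤ ((p : ℝ) + 1) ^ (1 / 2 : ℝ) := by gcongr; linarith
    _ ≤ ((p : ℝ) + 1) ^ (1 : ℝ) :=
      Real.rpow_le_rpow_of_exponent_le (by linarith) (by norm_num)
    _ = _ := Real.rpow_one _

lemma isBigO_eigenvalue_of_geometric (e : ℕ) (c : ℕ → ℝ) (hc : ∀ p, 0 ≤ c p) {a C : ℝ}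
    (ha : 1 < a) (hC : 0 < C)
    (h : ∀ᶠ p : ℕ in atTop, c p ≤ C * ((p : ℝ) ^ (1 / 2 : ℝ) * a ^ (-(p : ℝ)))) :
    (fun k => ∑' p, c p * sphereCoef e p k) =O[atTop]
      (fun k : ℕ => (k : ℝ) ^ (-((e : ℝ) + 1) + 1) * a ^ (-(k : ℝ))) := by
  obtain ⟨C2, hC2, h2⟩ := sphereCoef_le_exp e
  obtain ⟨N, hN⟩ := eventually_atTop.1 h
  have ha0 : 0 < a := by linarith
  have hs := summable_succ_pow_mul_geometric (e + 2) (r := a⁻¹) (by positivity) (inv_lt_one_of_one_lt₀ ha)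
  set T := ∑' m : ℕ, ((m : ℝ) + 1) ^ (e + 2) * a⁻¹ ^ m with hT
  set D : ℝ := ((e + 1).factorial : ℝ) * 4 ^ (e + 1) with hD
  have hD0 : 0 < D := by positivity
  refine IsBigO.of_bound (C * C2 * D * T) (eventually_atTop.2 ⟨max N 1, fun k hk => ?_⟩)
  have hkN : N ≤ k := (le_max_left _ _).trans hk
  have hk1 : 1 ≤ k := (le_max_right _ _).trans hk
  have hk1' : (1 : ℝ) ≤ k := by exact_mod_cast hk1
  have hk0 : (0 : ℝ) < k := by linarith
  have hrk : (k : ℝ) ^ (-((e : ℝ) + 1) + 1) = ((k : ℝ) ^ e)⁻¹ := by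
    rw [← Real.rpow_natCast, ← Real.rpow_neg hk0.le]; congr 1; ring
  have hak (m : ℕ) : a ^ (-(m : ℝ)) = a⁻¹ ^ m := by
    rw [Real.rpow_neg ha0.le, Real.rpow_natCast, inv_pow]
  -- With `p = m + k ≤ k(m + 1)` and `exp(-k²/(4p)) ≤ D (p/k²)^(e+1)`, bounding `√p` by `p` leaves
  -- `p^(e+2) / k^(2e+2) ≤ (m+1)^(e+2) k^(-e)`, and `-e = -d + 1`.
  have hterm (m : ℕ) : c (m + k) * sphereCoef e (m + k) k ≤
      C * C2 * D * ((k : ℝ) ^ (-((e : ℝ) + 1) + 1) * a ^ (-(k : ℝ))) *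
        (((m : ℝ) + 1) ^ (e + 2) * a⁻¹ ^ m) := by
    have hm0 : (0 : ℝ) ≤ m := m.cast_nonneg
    have hp0 : (0 : ℝ) < ((m + k : ℕ) : ℝ) := by exact_mod_cast (by omega : 0 < m + k)
    have hp1 : (1 : ℝ) ≤ ((m + k : ℕ) : ℝ) := by exact_mod_cast (by omega : 1 ≤ m + k)
    have hpk : ((m + k : ℕ) : ℝ) ≤ k * (m + 1) := by push_cast; nlinarith
    have hexp : Real.exp (-((k : ℝ) ^ 2 / (4 * ((m + k : ℕ) : ℝ)))) ≤
        D * (((m + k : ℕ) : ℝ) ^ (e + 1) * (((k : ℝ) ^ 2) ^ (e + 1))⁻¹) := by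
      refine (exp_neg_le_factorial_div_pow (by positivity) (e + 1)).trans_eq ?_
      rw [div_pow, mul_pow, hD]; field_simp
    have hhalf : ((m + k : ℕ) : ℝ) ^ (1 / 2 : ℝ) ≤ ((m + k : ℕ) : ℝ) := by
      nth_rw 2 [← Real.rpow_one ((m + k : ℕ) : ℝ)]
      exact Real.rpow_le_rpow_of_exponent_le hp1 (by norm_num)
    calc c (m + k) * sphereCoef e (m + k) k
        ≤ (C * (((m + k : ℕ) : ℝ) ^ (1 / 2 : ℝ) * a ^ (-((m + k : ℕ) : ℝ)))) *
          (C2 * Real.exp (-((k : ℝ) ^ 2 / (4 * ((m + k : ℕ) : ℝ))))) :=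
          mul_le_mul (hN _ (by omega)) (h2 _ k (by omega)) (sphereCoef_nonneg _ _ _)
            (by positivity)
      _ ≤ (C * (((m + k : ℕ) : ℝ) * a ^ (-((m + k : ℕ) : ℝ)))) *
          (C2 * (D * (((m + k : ℕ) : ℝ) ^ (e + 1) * (((k : ℝ) ^ 2) ^ (e + 1))⁻¹))) := by gcongr
      _ = C * C2 * D * (((m + k : ℕ) : ℝ) ^ (e + 2) * (((k : ℝ) ^ 2) ^ (e + 1))⁻¹) *
          (a⁻¹ ^ k * a⁻¹ ^ m) := by rw [hak, pow_add a⁻¹]; ring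
      _ ≤ C * C2 * D * (((k : ℝ) * (m + 1)) ^ (e + 2) * (((k : ℝ) ^ 2) ^ (e + 1))⁻¹) *
          (a⁻¹ ^ k * a⁻¹ ^ m) := by gcongr
      _ = _ := by
          have : ((k : ℝ) * (m + 1)) ^ (e + 2) * (((k : ℝ) ^ 2) ^ (e + 1))⁻¹ =
              ((k : ℝ) ^ e)⁻¹ * ((m : ℝ) + 1) ^ (e + 2) := by
            rw [mul_pow]; field_simp; ring
          rw [this, hrk, hak]; ring
  have hnn (p : ℕ) : 0 ≤ c p * sphereCoef e p k := mul_nonneg (hc p) (sphereCoef_nonneg _ _ _)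
  have hs' := hs.mul_left (C * C2 * D * ((k : ℝ) ^ (-((e : ℝ) + 1) + 1) * a ^ (-(k : ℝ))))
  have hs1 : Summable fun m => c (m + k) * sphereCoef e (m + k) k :=
    hs'.of_nonneg_of_le (fun m => hnn _) hterm
  have hs2 : Summable fun p => c p * sphereCoef e p k := (summable_nat_add_iff k).1 hs1
  rw [Real.norm_of_nonneg (tsum_nonneg hnn), Real.norm_of_nonneg (by positivity),
    ← hs2.sum_add_tsum_nat_add k, Finset.sum_eq_zero, zero_add]
  · refine (hs1.tsum_le_tsum hterm hs').trans_eq ?_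
    rw [tsum_mul_left, ← hT]; ring
  · intro p hp
    rw [sphereCoef_eq_zero (by have := Finset.mem_range.1 hp; omega), mul_zero]

lemma eigenvalue_ge_of_geometric (e : ℕ) (c : ℕ → ℝ) (hc : ∀ p, 0 ≤ c p) {a C : ℝ}
    (ha : 1 < a) (hC : 0 < C)
    (h : ∀ᶠ p : ℕ in atTop, C * ((p : ℝ) ^ (1 / 2 : ℝ) * a ^ (-(p : ℝ))) ≤ c p)
    (hs : ∀ k, Summable fun p => c p * sphereCoef e p k) :
    (fun k : ℕ => (k : ℝ) ^ (-((e : ℝ) + 1) / 2 + 1) * (2 : ℝ) ^ (-(k : ℝ)) * a ^ (-(k : ℝ)))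
      =O[atTop] (fun k => ∑' p, c p * sphereCoef e p k) := by
  obtain ⟨C2, hC2, h2⟩ := le_sphereCoef_diag e
  obtain ⟨N, hN⟩ := eventually_atTop.1 h
  have ha0 : 0 < a := by linarith
  refine IsBigO.of_bound (C * C2)⁻¹ (eventually_atTop.2 ⟨max N 1, fun k hk => ?_⟩)
  have hkN : N ≤ k := (le_max_left _ _).trans hk
  have hk1 : 1 ≤ k := (le_max_right _ _).trans hk
  have hk0 : (0 : ℝ) < k := by exact_mod_cast hk1
  have hnn (p : ℕ) : 0 ≤ c p * sphereCoef e p k := mul_nonneg (hc p) (sphereCoef_nonneg _ _ _)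
  rw [Real.norm_of_nonneg (tsum_nonneg hnn), Real.norm_of_nonneg (by positivity), inv_mul_eq_div,
    le_div_iff₀ (by positivity)]
  refine le_trans ?_ ((hs k).le_tsum k fun p _ => hnn p)
  refine le_trans (le_of_eq ?_) (mul_le_mul (hN k hkN) (h2 k hk1) (by positivity) (hc k))
  rw [show -((e : ℝ) + 1) / 2 + 1 = 1 / 2 + -(e : ℝ) / 2 by ring, Real.rpow_add hk0]
  ring

/-! ### Assembling the asymptotics -/

/-- A nonnegative function that is `O(g)` is eventually at most a positive multiple of `g`. -/
lemma exists_pos_eventually_le_of_isBigO {l : Filter ℕ} {f g : ℕ → ℝ} (hg : ∀ p, 0 ≤ g p)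
    (h : f =O[l] g) : ∃ C : ℝ, 0 < C ∧ ∀ᶠ p in l, f p ≤ C * g p := by
  obtain ⟨C, hC, h⟩ := h.exists_pos
  refine ⟨C, hC, h.bound.mono fun p hp => (le_abs_self _).trans ?_⟩
  rwa [Real.norm_of_nonneg (hg p)] at hp

lemma spectrum_of_power_law (e : ℕ) (c : ℕ → ℝ) (hc : ∀ p, 0 ≤ c p)
    (K : UnitSphere (e + 1) → UnitSphere (e + 1) → ℝ) (hK : IsDotProductKernel (e + 1) c K)
    {S : ℕ → Prop} (hS : ∀ k j, S (k + 2 * j) ↔ S k) (hS0 : ∀ p, ¬ S p → c p = 0) {a : ℝ}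
    (ha : 1 - ((e : ℝ) + 1) / 2 < a)
    (h : c =Θ[atTop ⊓ 𝓟 {p | S p}] (fun p : ℕ => (p : ℝ) ^ (-a))) :
    ∃ lam : ℕ → ℝ, IsSpectrum (e + 1) K lam ∧ (∀ k, ¬ S k → lam k = 0) ∧
      lam =Θ[atTop ⊓ 𝓟 {k | S k}] (fun k : ℕ => (k : ℝ) ^ (-((e : ℝ) + 1) - 2 * a + 2)) := by
  obtain ⟨C, hC, hle⟩ := exists_pos_eventually_le_of_isBigO (fun p => by positivity) h.1
  obtain ⟨D, hD, hge⟩ := exists_pos_eventually_le_of_isBigO hc h.2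
  rw [eventually_inf_principal] at hle hge
  have hle' : ∀ᶠ p : ℕ in atTop, c p ≤ C * (p : ℝ) ^ (-a) := hle.mono fun p hp => by
    by_cases hSp : S p
    · exact hp hSp
    · rw [hS0 p hSp]; positivity
  have hge' : ∀ᶠ p : ℕ in atTop, S p → D⁻¹ * (p : ℝ) ^ (-a) ≤ c p := hge.mono fun p hp hSp => by
    rw [inv_mul_le_iff₀ hD]; exact hp hSp
  have hsum : Summable fun p : ℕ => c p * (p : ℝ) ^ (-((e : ℝ) + 1) / 2) := by
    refine summable_of_isBigO_nat (Real.summable_nat_rpow.2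
      (by linarith : -(a + ((e : ℝ) + 1) / 2) < -1)) (IsBigO.of_bound C
        ((hle'.and (eventually_ge_atTop 1)).mono fun p hp => ?_))
    have hp0 : (0 : ℝ) < p := by exact_mod_cast hp.2
    rw [Real.norm_of_nonneg (mul_nonneg (hc p) (by positivity)), Real.norm_of_nonneg (by positivity),
      show -(a + ((e : ℝ) + 1) / 2) = -a + -((e : ℝ) + 1) / 2 by ring, Real.rpow_add hp0,
      ← mul_assoc]
    exact mul_le_mul_of_nonneg_right hp.1 (by positivity)
  obtain ⟨hs, hspec⟩ := isSpectrum_of_summable e c hc K hK (summable_mul_sphereCoef e c hc hsum)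
  refine ⟨_, hspec, fun k hk => ?_, (isBigO_eigenvalue_of_power_law e c hc ha hC hle').mono inf_le_left,
    eigenvalue_ge_of_power_law e c hc ha (inv_pos.2 hD) (fun k j => (hS k j).2) hge' hs⟩
  rw [← tsum_zero]
  congr 1
  ext p
  -- Each term has a zero factor: `sphereCoef` when the parities differ or `p < k`, and `c p`
  -- otherwise, since `S` then fails at `p` as it does at `k`.
  by_cases hp : k ≤ p ∧ p % 2 = k % 2
  · obtain ⟨j, rfl⟩ := exists_eq_add_two_mul hp
    rw [hS0 _ ((hS k j).not.2 hk), zero_mul]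
  · rw [sphereCoef_eq_zero hp, mul_zero]

theorem mainTheorem3 (d : ℕ) (hd : 1 ≤ d) (c : ℕ → ℝ) (hc : ∀ p, 0 ≤ c p)
    (K : UnitSphere d → UnitSphere d → ℝ) (hK : IsDotProductKernel d c K) :
    -- power-law coefficients
    (∀ a : ℝ, 1 - (d : ℝ) / 2 < a →
      c =Θ[atTop] (fun p : ℕ => (p : ℝ) ^ (-a)) →
      ∃ lam : ℕ → ℝ, IsSpectrum d K lam ∧
        lam =Θ[atTop] (fun k : ℕ => (k : ℝ) ^ (-(d : ℝ) - 2 * a + 2))) ∧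
    -- power-law coefficients, odd ones vanishing
    (∀ a : ℝ, 1 - (d : ℝ) / 2 < a →
      (∀ p, Odd p → c p = 0) →
      c =Θ[atTop ⊓ 𝓟 {p : ℕ | Even p}] (fun p : ℕ => (p : ℝ) ^ (-a)) →
      ∃ lam : ℕ → ℝ, IsSpectrum d K lam ∧
        (∀ k, Odd k → lam k = 0) ∧
        lam =Θ[atTop ⊓ 𝓟 {k : ℕ | Even k}]
          (fun k : ℕ => (k : ℝ) ^ (-(d : ℝ) - 2 * a + 2))) ∧
    -- power-law coefficients, even ones vanishing
    (∀ a : ℝ, 1 - (d : ℝ) / 2 < a →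
      (∀ p, Even p → c p = 0) →
      c =Θ[atTop ⊓ 𝓟 {p : ℕ | Odd p}] (fun p : ℕ => (p : ℝ) ^ (-a)) →
      ∃ lam : ℕ → ℝ, IsSpectrum d K lam ∧
        (∀ k, Even k → lam k = 0) ∧
        lam =Θ[atTop ⊓ 𝓟 {k : ℕ | Odd k}]
          (fun k : ℕ => (k : ℝ) ^ (-(d : ℝ) - 2 * a + 2))) ∧
    -- stretched-exponential coefficients
    (∀ a : ℝ, 0 < a →
      c =O[atTop] (fun p : ℕ => Real.exp (-a * √(p : ℝ))) →
      ∃ lam : ℕ → ℝ, IsSpectrum d K lam ∧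
        lam =O[atTop] (fun k : ℕ => (k : ℝ) ^ (-(d : ℝ) + 1 / 2) * Real.exp (-a * √(k : ℝ)))) ∧
    -- geometric coefficients
    (∀ a : ℝ, 1 < a →
      c =Θ[atTop] (fun p : ℕ => (p : ℝ) ^ (1 / 2 : ℝ) * a ^ (-(p : ℝ))) →
      ∃ lam : ℕ → ℝ, IsSpectrum d K lam ∧
        lam =O[atTop] (fun k : ℕ => (k : ℝ) ^ (-(d : ℝ) + 1) * a ^ (-(k : ℝ))) ∧
        (fun k : ℕ => (k : ℝ) ^ (-(d : ℝ) / 2 + 1) * (2 : ℝ) ^ (-(k : ℝ)) * a ^ (-(k : ℝ)))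
          =O[atTop] lam) := by
  obtain ⟨e, rfl⟩ : ∃ e, d = e + 1 := ⟨d - 1, by omega⟩
  rw [show ((e + 1 : ℕ) : ℝ) = (e : ℝ) + 1 by push_cast; ring]
  refine ⟨fun a ha h => ?_, fun a ha h0 h => ?_, fun a ha h0 h => ?_, fun a ha h => ?_,
    fun a ha h => ?_⟩
  · obtain ⟨lam, h1, -, h3⟩ := spectrum_of_power_law e c hc K hK (S := fun _ => True)
      (fun _ _ => Iff.rfl) (fun p hp => absurd trivial hp) ha (by simpa using h)
    exact ⟨lam, h1, by simpa using h3⟩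
  · obtain ⟨lam, h1, h2, h3⟩ := spectrum_of_power_law e c hc K hK (S := Even)
      (fun k j => by simp [Nat.even_add]) (fun p hp => h0 p (Nat.not_even_iff_odd.1 hp)) ha h
    exact ⟨lam, h1, fun k hk => h2 k (Nat.not_even_iff_odd.2 hk), h3⟩
  · obtain ⟨lam, h1, h2, h3⟩ := spectrum_of_power_law e c hc K hK (S := Odd)
      (fun k j => by simp [Nat.odd_add]) (fun p hp => h0 p (Nat.not_odd_iff_even.1 hp)) ha h
    exact ⟨lam, h1, fun k hk => h2 k (Nat.not_odd_iff_even.2 hk), h3⟩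
  · obtain ⟨C, hC, hle⟩ := exists_pos_eventually_le_of_isBigO (fun p => (Real.exp_pos _).le) h
    exact ⟨_, (isSpectrum_of_summable e c hc K hK (summable_mul_sphereCoef_of_summable e c hc
      (summable_of_isBigO_nat (summable_exp_neg_mul_sqrt ha) h))).2,
      isBigO_eigenvalue_of_stretched_exp e c hc ha hC hle⟩
  · have hnn (p : ℕ) : 0 ≤ (p : ℝ) ^ (1 / 2 : ℝ) * a ^ (-(p : ℝ)) := by
      have : 0 < a := by linarith
      positivity
    obtain ⟨C, hC, hle⟩ := exists_pos_eventually_le_of_isBigO hnn h.1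
    obtain ⟨D, hD, hge⟩ := exists_pos_eventually_le_of_isBigO hc h.2
    have hsum : Summable fun p : ℕ => (p : ℝ) ^ (1 / 2 : ℝ) * a ^ (-(p : ℝ)) := by
      have := summable_succ_pow_mul_geometric 1 (r := a⁻¹) (by positivity)
        (inv_lt_one_of_one_lt₀ ha)
      simp only [pow_one] at this
      exact this.of_nonneg_of_le hnn fun p => rpow_half_mul_le ha p
    obtain ⟨hs, hspec⟩ := isSpectrum_of_summable e c hc K hK
      (summable_mul_sphereCoef_of_summable e c hc (summable_of_isBigO_nat hsum h.1))
    exact ⟨_, hspec, isBigO_eigenvalue_of_geometric e c hc ha hC hle,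
      eigenvalue_ge_of_geometric e c hc ha (inv_pos.2 hD) (hge.mono fun p hp => by
        rw [inv_mul_le_iff₀ hD]; exact hp) hs⟩
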